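/- Setting. Let $X=(x_{ij})\in\mathbb{R}^{N\times d}$ have columns (feature vectors) $x^{(j)}=(x_{1j},\dots,x_{Nj})$, $j\in[d]$, and let $Y=(y_1,\dots,y_N)\in\mathbb{R}^N$ be the label vector. For $v\in\mathbb{R}^N$ let $\|v\|$ be the Euclidean norm, $\mu_v=\frac1N\sum_i v_i$, $\sigma_v=\bigl(\frac1N\sum_i(v_i-\mu_v)^2\bigr)^{1/2}$, and $|v\rangle=\frac1{\|v\|}\sum_i v_i|i\rangle$ its amplitude encoding on $\lceil\log_2N\rceil$ qubits. Assume $\sigma_{x^{(j)}}>0$ for all $j$ and $\sigma_Y>0$. The Pearson correlation coefficients are $$w_j=\frac{\sum_{i}(x_{ij}-\mu_{x^{(j)}})(y_i-\mu_Y)}{\sqrt{\sum_{i}(x_{ij}-\mu_{x^{(j)}})^2}\,\sqrt{\sum_{i}(y_i-\mu_Y)^2}},\qquad j\in[d].$$ Access and time. For each $v\in\{x^{(1)},\dots,x^{(d)},Y\}$ one can apply some unitary $U_v$ with $U_v|0\rangle=|v\rangle$ (its action on the other basis states is arbitrary) and its inverse, both also in controlled form, and one can read the number $\|v\|$; each such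 operation takes time $T$, where $T\ge\lceil\log_2 N\rceil$ (the number of qubits that $U_v$ acts on). A one-qubit gate takes time $1$, each control qubit of a gate or of a (un)loading operation adds $1$, and each qubit used in a run of a circuit adds $1$ for initialization and measurement. An algorithm is a classical controller (a decision tree whose choices may depend on measured bits and norms read, and whose leaves carry the output) that runs such circuits on fresh qubits and measures them in the computational basis. Theorem. There is a universal constant $C>0$ such that for all $N,d$, all $\varepsilon>0$, $\delta\in(0,1)$ and all real $\eta$ there is a quantum algorithm with the following property. For all $X,Y$ as above with $$\eta\ \ge\ \frac{7\max\bigl(\|x^{(j)}\|\,\|Y\|,\ \|x^{(j)}\|^2,\ \|Y\|^2\bigr)}{N\min\bigl(\sigma_{x^{(j)}}\sigma_Y,\ \sigma_{x^{(j)}}^2,\ \sigma_Y^2\bigr)}\qquad\text{for all } j\in[d],$$ the algorithm always stops within time $$C\,\frac{T\,d\,\eta}{\varepsilon}\,\log\frac{2}{\delta},$$ for every $T\ge\lceil\log_2N\rceil$, and for all unitaries $U_v$ as above it outputs estimates $\overline{w}_1,\dots,\overline{w}_d$ such that, for each $j\in[d]$, $|\overline{w}_j-w_j|\le\varepsilon$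 with probability at least $1-\delta$. In particular, for a constant success probability for each coefficient the total time is $O(Td\eta/\varepsilon)$. -/

import Mathlib

/-! ### Data: norms, means, standard deviations, Pearson correlation -/

noncomputable section

namespace PearsonQ

/-- Euclidean norm of a real vector. -/
def l2norm {N : ℕ} (v : Fin N → ℝ) : ℝ := Real.sqrt (∑ i, v i ^ 2)

def mean {N : ℕ} (v : Fin N → ℝ) : ℝ := (∑ i, v i) / N

/-- Population standard deviation. -/
def stdDev {N : ℕ} (v : Fin N → ℝ) : ℝ := Real.sqrt ((∑ i, (v i - mean v) ^ 2) / N)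

/-- Pearson correlation coefficient of two vectors. -/
def pearson {N : ℕ} (x y : Fin N → ℝ) : ℝ :=
  (∑ i, (x i - mean x) * (y i - mean y)) /
    (Real.sqrt (∑ i, (x i - mean x) ^ 2) * Real.sqrt (∑ i, (y i - mean y) ^ 2))

/-- The condition parameter `η` of a pair (feature vector, label vector). -/
def eta {N : ℕ} (x y : Fin N → ℝ) : ℝ :=
  7 * max (l2norm x * l2norm y) (max (l2norm x ^ 2) (l2norm y ^ 2)) /
    (N * min (stdDev x * stdDev y) (min (stdDev x ^ 2) (stdDev y ^ 2)))

/-! ### Quantum circuits with access to state-preparation unitaries -/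

/-- Names of the loadable vectors: the `d` feature vectors and the label vector. -/
inductive Source (d : ℕ) : Type
  | feature (j : Fin d)
  | label

/-- The vector stored under a name; the rows of `X` are examples, its columns are features. -/
def Source.vec {N d : ℕ} (X : Matrix (Fin N) (Fin d) ℝ) (Y : Fin N → ℝ) :
    Source d → Fin N → ℝ
  | .feature j => fun i => X i j
  | .label => Y

/-- Computational basis states of `q` qubits. -/
abbrev Bits (q : ℕ) : Type := Fin q → Bool

/-- Amplitude encoding `(1/‖v‖) ∑ i, v i |i⟩` of `v ∈ ℝ^N` on `⌈log₂ N⌉` qubits;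
the index `i` (counted from `0`) is written in binary. -/
def ampState {N : ℕ} (v : Fin N → ℝ) (b : Bits (Nat.clog 2 N)) : ℂ :=
  if h : Nat.ofBits b < N then ((v ⟨Nat.ofBits b, h⟩ / l2norm v : ℝ) : ℂ) else 0

/-- `O` gives, for each loadable vector, a unitary that maps `|0…0⟩` to its amplitude encoding.
Nothing is known about what the unitary does to the other basis states. -/
def IsLoader {N d : ℕ} (X : Matrix (Fin N) (Fin d) ℝ) (Y : Fin N → ℝ)
    (O : Source d → Matrix (Bits (Nat.clog 2 N)) (Bits (Nat.clog 2 N)) ℂ) : Prop :=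
  ∀ s : Source d, O s ∈ Matrix.unitaryGroup (Bits (Nat.clog 2 N)) ℂ ∧
    ∀ b, O s b (fun _ => false) = ampState (s.vec X Y) b

/-- Gates on `q` qubits; `n` is the width of the register that the loading unitaries act on.
`elem` is a one-qubit unitary, `load` a loading unitary and `unload` its inverse, each of them
controlled on all qubits in `ctrl` being `1` (`ctrl` may be empty). -/
inductive Gate (n d q : ℕ) : Type
  | elem (U : Matrix.unitaryGroup (Bits 1) ℂ) (reg : Fin 1 ↪ Fin q) (ctrl : Finset (Fin q))
      (h : ∀ i, reg i ∉ ctrl)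
  | load (s : Source d) (reg : Fin n ↪ Fin q) (ctrl : Finset (Fin q)) (h : ∀ i, reg i ∉ ctrl)
  | unload (s : Source d) (reg : Fin n ↪ Fin q) (ctrl : Finset (Fin q)) (h : ∀ i, reg i ∉ ctrl)

/-- The basis state `b` with the contents of the register `reg` replaced by `v`. -/
def overwrite {k q : ℕ} (reg : Fin k ↪ Fin q) (b : Bits q) (v : Bits k) : Bits q :=
  Function.extend reg v b

open Classical in
/-- Apply the matrix `M` to the qubits in `reg`, controlled on the qubits in `ctrl`. -/
def applyCtrl {k q : ℕ} (M : Matrix (Bits k) (Bits k) ℂ) (reg : Fin k ↪ Fin q)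
    (ctrl : Finset (Fin q)) (ψ : Bits q → ℂ) : Bits q → ℂ := fun b =>
  if ∀ i ∈ ctrl, b i = true then
    ∑ v : Bits k, M (fun i => b (reg i)) v * ψ (overwrite reg b v)
  else ψ b

def Gate.apply {n d q : ℕ} (O : Source d → Matrix (Bits n) (Bits n) ℂ) (ψ : Bits q → ℂ) :
    Gate n d q → Bits q → ℂ
  | .elem U reg ctrl _ => applyCtrl U.1 reg ctrl ψ
  | .load s reg ctrl _ => applyCtrl (O s) reg ctrl ψ
  | .unload s reg ctrl _ => applyCtrl (O s).conjTranspose reg ctrl ψ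

/-- A loading unitary or its inverse takes time `T`, a one-qubit gate takes time `1`, and each
control qubit adds `1`. -/
def Gate.time {n d q : ℕ} (T : ℝ) : Gate n d q → ℝ
  | .elem _ _ ctrl _ => 1 + ctrl.card
  | .load _ _ ctrl _ => T + ctrl.card
  | .unload _ _ ctrl _ => T + ctrl.card

/-- The state that a list of gates (applied from left to right) produces from `|0…0⟩`. -/
def finalState {n d q : ℕ} (O : Source d → Matrix (Bits n) (Bits n) ℂ) (c : List (Gate n d q)) :
    Bits q → ℂ :=
  c.foldl (fun ψ g => g.apply O ψ) (Pi.single (fun _ => false) 1)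

/-- A quantum algorithm that outputs `d` real numbers: a classical controller (a decision tree)
that can stop with an output, read the norm of a stored vector, or run a quantum circuit on fresh
qubits, measure all of them in the computational basis and continue according to the outcome. -/
inductive Algo (n d : ℕ) : Type
  | output (w : Fin d → ℝ)
  | readNorm (s : Source d) (next : ℝ → Algo n d)
  | run (q : ℕ) (c : List (Gate n d q)) (next : Bits q → Algo n d)

/-- `A.RunsWithin T nrm t`: on every branch the algorithm stops after time at most `t`, if the
stored norms are `nrm`. Loading unitaries and norm reads take time `T`; each qubit that is
used in a run takes time `1` for its initialization and measurement. -/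
def Algo.RunsWithin {n d : ℕ} (T : ℝ) (nrm : Source d → ℝ) : Algo n d → ℝ → Prop
  | .output _, t => 0 ≤ t
  | .readNorm s next, t => (next (nrm s)).RunsWithin T nrm (t - T)
  | .run q c next, t =>
      ∀ b, (next b).RunsWithin T nrm (t - (q + (c.map (Gate.time T)).sum))

open Classical in
/-- The probability that the output lies in `E`; outcomes are distributed by the Born rule. -/
def Algo.prob {n d : ℕ} (O : Source d → Matrix (Bits n) (Bits n) ℂ) (nrm : Source d → ℝ)
    (E : Set (Fin d → ℝ)) : Algo n d → ℝ
  | .output w => if w ∈ E then 1 else 0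
  | .readNorm s next => (next (nrm s)).prob O nrm E
  | .run _ c next => ∑ b, ‖finalState O c b‖ ^ 2 * (next b).prob O nrm E

end PearsonQ

end

/-!
The correlation of a feature vector `x` with the label vector `y` is
`(a - b c) / √((1 - b²) (1 - c²))`, where `a` is the cosine of the angle between `x` and `y`, and
`b`, `c` are the cosines of their angles with the constant vector (`pearson_eq`). The condition
parameter says that `1 - b²` and `1 - c²` are at least `7 / η` (`seven_div_le_of_eta_le`), so it
suffices to know `a`, `b`, `c` up to a small multiple of `ε / η` (`abs_correlation_sub_le`).

Each of these cosines is, up to a known factor, an overlap `⟨x|s⟩` of a stored vector with a state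
`|s⟩` that is either stored or the uniform superposition of all basis states. With one ancilla,
controlled loading and two rotations, a circuit has the amplitude `⟨0|A|0⟩ = cos θ` affine in the
overlap, and the rotations are chosen such that `θ` lies between `π/3` and `5π/12`
(`runCircuit_overlapCircuit`, `windowAngle_mem`). After `m` Grover iterations, the outcome `0…0`
has probability `cos² ((2m+1)θ)` (`norm_sq_finalState_grover`).

These probabilities are estimated, for `m = 2^i - 1` and `m = 2^i` and all `i < K`, up to the
constant error `1/24`. Any angle of the window that is consistent with the estimates is then within
`O(2⁻ᴷ)` of `θ` (`angle_close_of_levels`): a difference of squared cosines is a product of the sines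
of the sum and of the difference, and the restriction to the window keeps the sine of the sum away
from zero for one of the two odd multiples on each level. So `2^K` of order `η / ε` is enough, no
quantum Fourier transform is needed, and the circuits need not depend on earlier outcomes.

By the Chernoff bound (`le_prob_sample`), `O(l + K - i)` runs on level `i` make the estimates fail
with probability at most `exp (-l - (K - i))` up to a constant. The sum over the levels is
`O(exp (-l))`, and the total time is a multiple of `∑ i < K, (l + K - i) 2^i T = O(l 2^K T)`: the
levels that need many runs are cheap, so there is no additional logarithm of `η / ε`.
-/

noncomputable section

namespace PearsonQ

open Matrix

/-! ### Linear algebra of controlled gates -/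

section Overwrite

variable {k q : ℕ} (reg : Fin k ↪ Fin q) (b : Bits q) (v w : Bits k)

theorem overwrite_reg (i : Fin k) : overwrite reg b v (reg i) = v i :=
  reg.injective.extend_apply v b i

theorem overwrite_of_ne {i : Fin q} (h : ∀ l, reg l ≠ i) : overwrite reg b v i = b i :=
  Function.extend_apply' _ _ _ (by rintro ⟨l, hl⟩; exact h l hl)

theorem overwrite_overwrite : overwrite reg (overwrite reg b v) w = overwrite reg b w := by
  funext i
  by_cases h : ∃ l, reg l = i
  · obtain ⟨l, rfl⟩ := h
    simp only [overwrite_reg]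
  · push Not at h
    simp only [overwrite_of_ne reg _ _ h]

theorem overwrite_self : overwrite reg b (fun i => b (reg i)) = b := by
  funext i
  by_cases h : ∃ l, reg l = i
  · obtain ⟨l, rfl⟩ := h
    simp only [overwrite_reg]
  · push Not at h
    simp only [overwrite_of_ne reg _ _ h]

theorem forall_ctrl_overwrite {ctrl : Finset (Fin q)} (h : ∀ i, reg i ∉ ctrl) :
    (∀ i ∈ ctrl, overwrite reg b v i = true) ↔ ∀ i ∈ ctrl, b i = true := by
  refine forall₂_congr fun i hi => ?_
  rw [overwrite_of_ne reg b v (fun l hl => h l (hl ▸ hi))]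

end Overwrite

section ApplyCtrl

variable {k q : ℕ} (M M' : Matrix (Bits k) (Bits k) ℂ) (reg : Fin k ↪ Fin q)
  {ctrl : Finset (Fin q)} (ψ χ : Bits q → ℂ)

theorem applyCtrl_add : applyCtrl M reg ctrl (ψ + χ) =
    applyCtrl M reg ctrl ψ + applyCtrl M reg ctrl χ := by
  funext b
  simp only [applyCtrl, Pi.add_apply]
  split_ifs
  · simp only [mul_add, Finset.sum_add_distrib]
  · rfl

theorem applyCtrl_smul (a : ℂ) : applyCtrl M reg ctrl (a • ψ) = a • applyCtrl M reg ctrl ψ := by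
  funext b
  simp only [applyCtrl, Pi.smul_apply, smul_eq_mul]
  split_ifs
  · rw [Finset.mul_sum]
    exact Finset.sum_congr rfl fun v _ => by ring
  · rfl

theorem applyCtrl_applyCtrl (h : ∀ i, reg i ∉ ctrl) :
    applyCtrl M reg ctrl (applyCtrl M' reg ctrl ψ) = applyCtrl (M * M') reg ctrl ψ := by
  funext b
  by_cases hb : ∀ i ∈ ctrl, b i = true
  · simp only [applyCtrl, if_pos hb, forall_ctrl_overwrite reg b _ h, overwrite_reg,
      overwrite_overwrite, Matrix.mul_apply, Finset.sum_mul, Finset.mul_sum]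
    rw [Finset.sum_comm]
    exact Finset.sum_congr rfl fun v _ => Finset.sum_congr rfl fun w _ => by ring
  · simp only [applyCtrl, if_neg hb]

theorem applyCtrl_one : applyCtrl 1 reg ctrl ψ = ψ := by
  funext b
  simp only [applyCtrl, Matrix.one_apply, ite_mul, one_mul, zero_mul, Finset.sum_ite_eq,
    Finset.mem_univ, if_true, overwrite_self, ite_self]

/-- The adjoint of a controlled operation is the controlled adjoint. The sum over pairs (basis
state, new register content) is reindexed by swapping the old and the new register content. -/
theorem star_dotProduct_applyCtrl (h : ∀ i, reg i ∉ ctrl) :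
    star χ ⬝ᵥ applyCtrl M reg ctrl ψ = star (applyCtrl Mᴴ reg ctrl χ) ⬝ᵥ ψ := by
  classical
  let P : Bits q → Prop := fun b => ∀ i ∈ ctrl, b i = true
  let F : Bits q × Bits k → ℂ := fun x =>
    if P x.1 then star (χ x.1) * (M (fun i => x.1 (reg i)) x.2 * ψ (overwrite reg x.1 x.2)) else 0
  let e : Bits q × Bits k → Bits q × Bits k :=
    fun x => (overwrite reg x.1 x.2, fun i => x.1 (reg i))
  have he : Function.Involutive e := fun x => by
    simp only [e, overwrite_overwrite, overwrite_self, overwrite_reg]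
  have hL : star χ ⬝ᵥ applyCtrl M reg ctrl ψ =
      ∑ x, F x + ∑ b, if P b then 0 else star (χ b) * ψ b := by
    rw [Fintype.sum_prod_type, ← Finset.sum_add_distrib]
    refine Finset.sum_congr rfl fun b _ => ?_
    by_cases hb : ∀ i ∈ ctrl, b i = true
    · simp only [applyCtrl, F, P, if_pos hb, Pi.star_apply, Finset.mul_sum, add_zero]
    · simp only [applyCtrl, F, P, if_neg hb, Pi.star_apply, Finset.sum_const_zero, zero_add]
  have hR : star (applyCtrl Mᴴ reg ctrl χ) ⬝ᵥ ψ =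
      ∑ x, F (e x) + ∑ b, if P b then 0 else star (χ b) * ψ b := by
    rw [Fintype.sum_prod_type, ← Finset.sum_add_distrib]
    refine Finset.sum_congr rfl fun b _ => ?_
    by_cases hb : ∀ i ∈ ctrl, b i = true
    · simp only [applyCtrl, F, P, e, forall_ctrl_overwrite reg b _ h, if_pos hb, Pi.star_apply,
        overwrite_reg, overwrite_overwrite, overwrite_self, star_sum, star_mul', Finset.sum_mul,
        conjTranspose_apply, star_star, add_zero]
      exact Finset.sum_congr rfl fun v _ => by ring
    · simp only [applyCtrl, F, P, e, forall_ctrl_overwrite reg b _ h, if_neg hb, Pi.star_apply,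
        Finset.sum_const_zero, zero_add]
  rw [hL, hR, ← Equiv.sum_comp (Function.Involutive.toPerm e he) F]
  rfl

end ApplyCtrl

/-! ### Circuits as linear isometries -/

section Circuit

variable {n d q : ℕ} {O : Source d → Matrix (Bits n) (Bits n) ℂ}

/-- The inverse gate, which takes the same time. -/
def Gate.inv : Gate n d q → Gate n d q
  | .elem U reg ctrl h => .elem U⁻¹ reg ctrl h
  | .load s reg ctrl h => .unload s reg ctrl h
  | .unload s reg ctrl h => .load s reg ctrl h

theorem Gate.time_inv (T : ℝ) (g : Gate n d q) : g.inv.time T = g.time T := by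
  cases g <;> rfl

/-- The state that a circuit makes of the state `ψ`. -/
def runCircuit (O : Source d → Matrix (Bits n) (Bits n) ℂ) (c : List (Gate n d q))
    (ψ : Bits q → ℂ) : Bits q → ℂ :=
  c.foldl (fun ψ g => g.apply O ψ) ψ

/-- The inverse circuit. -/
def invCircuit (c : List (Gate n d q)) : List (Gate n d q) := (c.map Gate.inv).reverse

/-- The total time of the gates of a circuit. -/
def gatesTime (T : ℝ) (c : List (Gate n d q)) : ℝ := (c.map (Gate.time T)).sum

theorem gatesTime_append (T : ℝ) (c c' : List (Gate n d q)) :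
    gatesTime T (c ++ c') = gatesTime T c + gatesTime T c' := by
  simp [gatesTime]

theorem gatesTime_cons (T : ℝ) (g : Gate n d q) (c : List (Gate n d q)) :
    gatesTime T (g :: c) = g.time T + gatesTime T c := by
  simp [gatesTime]

theorem gatesTime_nil (T : ℝ) : gatesTime T ([] : List (Gate n d q)) = 0 := rfl

theorem gatesTime_inv (T : ℝ) (c : List (Gate n d q)) :
    gatesTime T (invCircuit c) = gatesTime T c := by
  simp [gatesTime, invCircuit, List.sum_reverse, Function.comp_def, Gate.time_inv]

theorem runCircuit_nil (ψ : Bits q → ℂ) : runCircuit O [] ψ = ψ := rfl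

theorem runCircuit_cons (g : Gate n d q) (c : List (Gate n d q)) (ψ : Bits q → ℂ) :
    runCircuit O (g :: c) ψ = runCircuit O c (g.apply O ψ) := rfl

theorem runCircuit_append (c c' : List (Gate n d q)) (ψ : Bits q → ℂ) :
    runCircuit O (c ++ c') ψ = runCircuit O c' (runCircuit O c ψ) :=
  List.foldl_append

theorem Gate.apply_add (g : Gate n d q) (ψ χ : Bits q → ℂ) :
    g.apply O (ψ + χ) = g.apply O ψ + g.apply O χ := by
  cases g <;> exact applyCtrl_add _ _ _ _

theorem Gate.apply_smul (g : Gate n d q) (a : ℂ) (ψ : Bits q → ℂ) :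
    g.apply O (a • ψ) = a • g.apply O ψ := by
  cases g <;> exact applyCtrl_smul _ _ _ _

theorem runCircuit_add (c : List (Gate n d q)) (ψ χ : Bits q → ℂ) :
    runCircuit O c (ψ + χ) = runCircuit O c ψ + runCircuit O c χ := by
  induction c generalizing ψ χ with
  | nil => rfl
  | cons g c ih => simp only [runCircuit_cons, Gate.apply_add, ih]

theorem runCircuit_smul (c : List (Gate n d q)) (a : ℂ) (ψ : Bits q → ℂ) :
    runCircuit O c (a • ψ) = a • runCircuit O c ψ := by
  induction c generalizing ψ with
  | nil => rfl
  | cons g c ih => simp only [runCircuit_cons, Gate.apply_smul, ih]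

theorem Gate.inv_apply_apply (hO : ∀ s, O s ∈ unitaryGroup (Bits n) ℂ) (g : Gate n d q)
    (ψ : Bits q → ℂ) : g.inv.apply O (g.apply O ψ) = ψ := by
  cases g with
  | elem U reg ctrl h =>
    simp only [Gate.inv, Gate.apply, applyCtrl_applyCtrl _ _ _ _ h]
    rw [← UnitaryGroup.mul_val, inv_mul_cancel, UnitaryGroup.one_val, applyCtrl_one]
  | load s reg ctrl h =>
    simp only [Gate.inv, Gate.apply, applyCtrl_applyCtrl _ _ _ _ h]
    rw [← star_eq_conjTranspose, mem_unitaryGroup_iff'.1 (hO s), applyCtrl_one]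
  | unload s reg ctrl h =>
    simp only [Gate.inv, Gate.apply, applyCtrl_applyCtrl _ _ _ _ h]
    rw [← star_eq_conjTranspose, mem_unitaryGroup_iff.1 (hO s), applyCtrl_one]

theorem Gate.star_dotProduct_apply (g : Gate n d q) (ψ χ : Bits q → ℂ) :
    star χ ⬝ᵥ g.apply O ψ = star (g.inv.apply O χ) ⬝ᵥ ψ := by
  cases g with
  | elem U reg ctrl h => exact star_dotProduct_applyCtrl _ _ _ _ h
  | load s reg ctrl h => exact star_dotProduct_applyCtrl _ _ _ _ h
  | unload s reg ctrl h =>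
    simpa only [conjTranspose_conjTranspose, Gate.inv, Gate.apply] using
      star_dotProduct_applyCtrl (O s)ᴴ reg ψ χ h

theorem runCircuit_inv_runCircuit (hO : ∀ s, O s ∈ unitaryGroup (Bits n) ℂ)
    (c : List (Gate n d q)) (ψ : Bits q → ℂ) :
    runCircuit O (invCircuit c) (runCircuit O c ψ) = ψ := by
  induction c generalizing ψ with
  | nil => rfl
  | cons g c ih =>
    have : invCircuit (g :: c) = invCircuit c ++ [g.inv] := by simp [invCircuit]
    rw [this, runCircuit_append, runCircuit_cons, runCircuit_cons, ih]
    exact g.inv_apply_apply hO ψ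

theorem star_dotProduct_runCircuit (c : List (Gate n d q)) (ψ χ : Bits q → ℂ) :
    star χ ⬝ᵥ runCircuit O c ψ = star (runCircuit O (invCircuit c) χ) ⬝ᵥ ψ := by
  induction c generalizing ψ with
  | nil => rfl
  | cons g c ih =>
    have : invCircuit (g :: c) = invCircuit c ++ [g.inv] := by simp [invCircuit]
    rw [this, runCircuit_append, runCircuit_cons, ih, g.star_dotProduct_apply]
    rfl

/-- The basis state `|0…0⟩`. -/
def zeroKet (q : ℕ) : Bits q → ℂ := Pi.single (fun _ => false) 1

theorem star_zeroKet_dotProduct (ψ : Bits q → ℂ) :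
    star (zeroKet q) ⬝ᵥ ψ = ψ (fun _ => false) := by
  simp [zeroKet]

theorem zeroKet_zero : zeroKet q (fun _ => false) = 1 := by simp [zeroKet]

/-- The Born rule yields a probability distribution. -/
theorem sum_norm_sq_finalState (hO : ∀ s, O s ∈ unitaryGroup (Bits n) ℂ)
    (c : List (Gate n d q)) : ∑ b, ‖finalState O c b‖ ^ 2 = 1 := by
  have h : star (finalState O c) ⬝ᵥ finalState O c = 1 := by
    change star (finalState O c) ⬝ᵥ runCircuit O c (zeroKet q) = 1
    rw [star_dotProduct_runCircuit]
    change star (runCircuit O (invCircuit c) (runCircuit O c (zeroKet q))) ⬝ᵥ _ = 1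
    rw [runCircuit_inv_runCircuit hO, star_zeroKet_dotProduct, zeroKet_zero]
  have h' : ((∑ b, ‖finalState O c b‖ ^ 2 : ℝ) : ℂ) = 1 := by
    rw [← h]
    push_cast
    refine Finset.sum_congr rfl fun b _ => ?_
    exact (Complex.conj_mul' _).symm
  exact_mod_cast h'

/-- `⟨0|c⁻¹|0⟩` is the complex conjugate of `⟨0|c|0⟩`. -/
theorem runCircuit_inv_zeroKet (c : List (Gate n d q)) :
    runCircuit O (invCircuit c) (zeroKet q) (fun _ => false) =
      star (runCircuit O c (zeroKet q) (fun _ => false)) := by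
  have h := star_dotProduct_runCircuit (O := O) c (zeroKet q) (zeroKet q)
  rw [star_zeroKet_dotProduct] at h
  rw [h, ← star_dotProduct_star, star_star, star_zeroKet_dotProduct]

end Circuit

/-! ### One-qubit gates -/

section OneQubit

/-- A `2 × 2` unitary as a one-qubit gate. -/
def oneQubit (M : unitaryGroup Bool ℂ) : unitaryGroup (Bits 1) ℂ :=
  ⟨M.1.submatrix (Equiv.funUnique (Fin 1) Bool) (Equiv.funUnique (Fin 1) Bool), by
    rw [mem_unitaryGroup_iff, star_eq_conjTranspose, conjTranspose_submatrix,
      submatrix_mul_equiv, ← star_eq_conjTranspose, mem_unitaryGroup_iff.1 M.2,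
      submatrix_one_equiv]⟩

/-- The register that consists of a single qubit. -/
def wire {q : ℕ} (i : Fin q) : Fin 1 ↪ Fin q := ⟨fun _ => i, Function.injective_of_subsingleton _⟩

theorem overwrite_wire {q : ℕ} (i : Fin q) (b : Bits q) (v : Bits 1) :
    overwrite (wire i) b v = Function.update b i (v 0) := by
  funext j
  by_cases h : j = i
  · subst h
    rw [Function.update_self]
    exact overwrite_reg (wire j) b v 0
  · rw [overwrite_of_ne _ _ _ (fun _ hl => h hl.symm), Function.update_of_ne h]

theorem applyCtrl_oneQubit {q : ℕ} (M : unitaryGroup Bool ℂ) (i : Fin q) (ctrl : Finset (Fin q))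
    (ψ : Bits q → ℂ) (b : Bits q) :
    applyCtrl (oneQubit M).1 (wire i) ctrl ψ b =
      if ∀ l ∈ ctrl, b l = true then
        M.1 (b i) true * ψ (Function.update b i true) +
          M.1 (b i) false * ψ (Function.update b i false)
      else ψ b := by
  unfold applyCtrl
  refine if_congr Iff.rfl ?_ rfl
  rw [← (Equiv.funUnique (Fin 1) Bool).symm.sum_comp, Fintype.sum_bool]
  simp only [overwrite_wire]
  rfl

/-- The rotation `|0⟩ ↦ cos β |0⟩ + sin β |1⟩`, `|1⟩ ↦ -sin β |0⟩ + cos β |1⟩`. -/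
def rot (β : ℝ) : unitaryGroup Bool ℂ :=
  ⟨of fun r c => (((if r = c then Real.cos β else if r then Real.sin β else -Real.sin β : ℝ)) : ℂ),
    by
    have h : Complex.cos β * Complex.cos β + Complex.sin β * Complex.sin β = 1 := by
      rw [← sq, ← sq, Complex.cos_sq_add_sin_sq]
    rw [mem_unitaryGroup_iff, star_eq_conjTranspose]
    ext r c
    cases r <;> cases c <;> simp [mul_apply, -Complex.ofReal_cos, -Complex.ofReal_sin] <;>
      push_cast <;> first | linear_combination h | ring⟩

/-- The bit flip `X`. -/
def pauliX : unitaryGroup Bool ℂ :=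
  ⟨of fun r c => if r = c then 0 else 1, by
    rw [mem_unitaryGroup_iff, star_eq_conjTranspose]
    ext r c
    cases r <;> cases c <;> simp [mul_apply]⟩

/-- The phase flip `Z`. -/
def pauliZ : unitaryGroup Bool ℂ :=
  ⟨of fun r c => if r = c then (if r then -1 else 1) else 0, by
    rw [mem_unitaryGroup_iff, star_eq_conjTranspose]
    ext r c
    cases r <;> cases c <;> simp [mul_apply]⟩

end OneQubit

/-! ### Reflection in the initial state -/

section Reflection

variable {n d q : ℕ} {O : Source d → Matrix (Bits n) (Bits n) ℂ}

/-- Bit flips on the qubits of a list. -/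
def flips (l : List (Fin q)) : List (Gate n d q) :=
  l.map fun i => .elem (oneQubit pauliX) (wire i) ∅ (by simp)

theorem runCircuit_flips {l : List (Fin q)} (hl : l.Nodup) (ψ : Bits q → ℂ) (b : Bits q) :
    runCircuit O (flips l) ψ b = ψ fun i => if i ∈ l then !b i else b i := by
  induction l generalizing ψ with
  | nil => simp [flips, runCircuit_nil]
  | cons x l ih =>
    have hx := (List.nodup_cons.1 hl).1
    change runCircuit O (flips l) (applyCtrl (oneQubit pauliX).1 (wire x) ∅ ψ) b = _
    rw [ih (List.nodup_cons.1 hl).2, applyCtrl_oneQubit]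
    have key : ∀ c : Bool, c = !b x → Function.update (fun i => if i ∈ l then !b i else b i) x c =
        fun i => if i ∈ x :: l then !b i else b i := by
      rintro c rfl
      funext i
      by_cases hi : i = x
      · subst hi; simp
      · simp [hi]
    cases hb : b x
    · simp [pauliX, hx, key true (by simp [hb])]
    · simp [pauliX, hx, key false (by simp [hb])]

/-- A circuit for `1 - 2|0…0⟩⟨0…0|`: a `Z` controlled on all other qubits negates `|1…1⟩`, and is
conjugated by bit flips. -/
def reflectZero (n d q : ℕ) : List (Gate n d (q + 1)) :=
  flips (List.finRange (q + 1)) ++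
    (.elem (oneQubit pauliZ) (wire 0) (Finset.univ.erase 0) (by simp [wire]) ::
      flips (List.finRange (q + 1)))

theorem runCircuit_reflectZero (ψ : Bits (q + 1) → ℂ) :
    runCircuit O (reflectZero n d q) ψ =
      ψ - (2 * ψ fun _ => false) • zeroKet (q + 1) := by
  have hflip : ∀ χ : Bits (q + 1) → ℂ,
      runCircuit O (flips (List.finRange (q + 1))) χ = fun b => χ fun i => !b i := fun χ => by
    funext b
    rw [runCircuit_flips (List.nodup_finRange _)]
    simp
  funext b
  rw [reflectZero, runCircuit_append, runCircuit_cons, hflip, hflip]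
  change applyCtrl (oneQubit pauliZ).1 (wire (0 : Fin (q + 1))) (Finset.univ.erase 0)
    (fun b => ψ fun i => !b i) (fun i => !b i) = _
  rw [applyCtrl_oneQubit]
  have hupd : Function.update (fun i : Fin (q + 1) => !b i) 0 (!b 0) = fun i => !b i :=
    Function.update_eq_self 0 (fun i => !b i)
  by_cases hb : b = fun _ => false
  · subst hb
    simp only [Bool.not_false]
    simp [pauliZ, zeroKet]
    ring
  · have h0 : zeroKet (q + 1) b = 0 := by simp [zeroKet, hb]
    rw [Pi.sub_apply, Pi.smul_apply, h0, smul_zero, sub_zero]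
    split_ifs with hc
    · have hb0 : b 0 = true := by
        by_contra h0
        apply hb
        funext i
        by_cases hi : i = 0
        · subst hi; simpa using h0
        · simpa using hc i (by simp [hi])
      rw [hb0, Bool.not_true] at hupd
      simp [pauliZ, hb0, hupd]
    · simp

theorem gatesTime_reflectZero (T : ℝ) : gatesTime T (reflectZero n d q) = 3 * (q + 1) := by
  have hf : gatesTime T (flips (n := n) (d := d) (List.finRange (q + 1))) = q + 1 := by
    simp [gatesTime, flips, Function.comp_def, Gate.time]
  rw [reflectZero, gatesTime_append, gatesTime_cons, hf]
  simp [Gate.time]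
  ring

end Reflection

/-! ### A circuit whose amplitude is an affine function of an overlap -/

section Overlap

variable {n d : ℕ} {O : Source d → Matrix (Bits n) (Bits n) ℂ}

/-- A basis state with its first qubit, the ancilla, split off. -/
def bcons (c : Bool) (b : Bits n) : Bits (n + 1) := Fin.cons c b

theorem bcons_zero (c : Bool) (b : Bits n) : bcons c b 0 = c := rfl

theorem bcons_false : bcons false (fun _ : Fin n => false) = fun _ => false := by
  funext i
  refine Fin.cases rfl (fun i => rfl) i

theorem update_bcons_zero (c c' : Bool) (b : Bits n) :
    Function.update (bcons c b) 0 c' = bcons c' b := Fin.update_cons_zero _ _ _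

theorem update_bcons_succ (c c' : Bool) (b : Bits n) (i : Fin n) :
    Function.update (bcons c b) i.succ c' = bcons c (Function.update b i c') :=
  (Fin.cons_update _ _ _ _).symm

/-- All qubits but the ancilla. -/
def dataReg (n : ℕ) : Fin n ↪ Fin (n + 1) := ⟨Fin.succ, Fin.succ_injective n⟩

theorem overwrite_dataReg (c : Bool) (b v : Bits n) :
    overwrite (dataReg n) (bcons c b) v = bcons c v := by
  funext i
  refine Fin.cases ?_ (fun i => ?_) i
  · exact overwrite_of_ne _ _ _ fun l => Fin.succ_ne_zero l
  · exact overwrite_reg (dataReg n) _ _ i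

theorem dataReg_notMem (i : Fin n) : dataReg n i ∉ ({0} : Finset (Fin (n + 1))) := by
  simp [dataReg, Fin.succ_ne_zero]

theorem applyCtrl_dataReg_false (M : Matrix (Bits n) (Bits n) ℂ) (ψ : Bits (n + 1) → ℂ)
    (b : Bits n) : applyCtrl M (dataReg n) {0} ψ (bcons false b) = ψ (bcons false b) := by
  simp [applyCtrl, bcons_zero]

theorem applyCtrl_dataReg_true (M : Matrix (Bits n) (Bits n) ℂ) (ψ : Bits (n + 1) → ℂ)
    (b : Bits n) : applyCtrl M (dataReg n) {0} ψ (bcons true b) =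
      ∑ v, M b v * ψ (bcons true v) := by
  simp only [applyCtrl, Finset.mem_singleton, forall_eq, bcons_zero, if_true, overwrite_dataReg]
  rfl

/-- Preparation, controlled on the ancilla, of a stored vector (`some s`) or of the uniform
superposition of all basis states (`none`) on the other qubits. -/
def prepare : Option (Source d) → List (Gate n d (n + 1))
  | some s => [.load s (dataReg n) {0} dataReg_notMem]
  | none => (List.finRange n).map fun i =>
      .elem (oneQubit (rot (Real.pi / 4))) (wire i.succ) {0} fun _ => dataReg_notMem i

/-- The amplitudes of the state that `prepare` makes of `|0…0⟩`. -/
def preparedState (O : Source d → Matrix (Bits n) (Bits n) ℂ) : Option (Source d) → Bits n → ℂ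
  | some s => fun b => O s b fun _ => false
  | none => fun _ => ((Real.sqrt 2)⁻¹ : ℂ) ^ n

theorem runCircuit_hadamards {l : List (Fin n)} (hl : l.Nodup) (ψ : Bits (n + 1) → ℂ) (y : ℂ)
    (hψ : ∀ b, ψ (bcons true b) = if ∀ i ∈ l, b i = false then y else 0) (b : Bits n) :
    runCircuit O (l.map fun i => (.elem (oneQubit (rot (Real.pi / 4))) (wire i.succ) {0}
        fun _ => dataReg_notMem i : Gate n d (n + 1))) ψ (bcons true b) =
      y * ((Real.sqrt 2)⁻¹ : ℂ) ^ l.length ∧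
    runCircuit O (l.map fun i => (.elem (oneQubit (rot (Real.pi / 4))) (wire i.succ) {0}
        fun _ => dataReg_notMem i : Gate n d (n + 1))) ψ (bcons false b) = ψ (bcons false b) := by
  induction l generalizing ψ y with
  | nil => simp [runCircuit_nil, hψ]
  | cons x l ih =>
    rw [List.map_cons, runCircuit_cons]
    have hx := (List.nodup_cons.1 hl).1
    have h1 : ∀ b : Bits n, applyCtrl (oneQubit (rot (Real.pi / 4))).1 (wire x.succ) {0} ψ
        (bcons true b) = if ∀ i ∈ l, b i = false then y * (Real.sqrt 2 : ℂ)⁻¹ else 0 := fun b => by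
      have hs : ((Real.sqrt 2 / 2 : ℝ) : ℂ) = (Real.sqrt 2 : ℂ)⁻¹ := by
        rw [Real.sqrt_div_self', one_div, Complex.ofReal_inv]
      have hsupp : (∀ i ∈ x :: l, Function.update b x false i = false) ↔ ∀ i ∈ l, b i = false := by
        rw [List.forall_mem_cons, Function.update_self]
        simp only [true_and]
        refine forall₂_congr fun i hi => ?_
        rw [Function.update_of_ne (ne_of_mem_of_not_mem hi hx)]
      rw [applyCtrl_oneQubit]
      simp only [Finset.mem_singleton, forall_eq, bcons_zero, if_true, update_bcons_succ, hψ,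
        hsupp]
      rw [if_neg (fun h => by simpa using h x (by simp))]
      have hrot : (rot (Real.pi / 4)).1 (bcons true b x.succ) false = (Real.sqrt 2 : ℂ)⁻¹ := by
        rw [← hs]
        cases h : bcons true b x.succ <;> simp [rot, -Complex.ofReal_div]
      rw [hrot, mul_zero, zero_add, mul_ite, mul_zero, mul_comm]
    have h2 : applyCtrl (oneQubit (rot (Real.pi / 4))).1 (wire x.succ) {0} ψ (bcons false b) =
        ψ (bcons false b) := by
      rw [applyCtrl_oneQubit]
      simp [bcons_zero]
    obtain ⟨ih1, ih2⟩ := ih (List.nodup_cons.1 hl).2 _ _ h1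
    refine ⟨?_, ih2.trans h2⟩
    refine ih1.trans ?_
    rw [List.length_cons, pow_succ]
    ring

theorem runCircuit_prepare (p : Option (Source d)) (ψ : Bits (n + 1) → ℂ) (y : ℂ)
    (hψ : ∀ b, ψ (bcons true b) = if b = fun _ => false then y else 0) (b : Bits n) :
    runCircuit O (prepare p) ψ (bcons true b) = y * preparedState O p b ∧
      runCircuit O (prepare p) ψ (bcons false b) = ψ (bcons false b) := by
  cases p with
  | some s =>
    refine ⟨?_, applyCtrl_dataReg_false _ _ _⟩
    refine (applyCtrl_dataReg_true _ _ _).trans ?_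
    simp [hψ, preparedState, mul_comm]
  | none =>
    have := runCircuit_hadamards (O := O) (List.nodup_finRange n) ψ y
      (fun b => by simp [hψ, funext_iff]) b
    simpa [preparedState, prepare] using this

/-- The inner product of the vector stored under `t` with the state that `prepare p` makes. -/
def overlap (O : Source d → Matrix (Bits n) (Bits n) ℂ) (p : Option (Source d)) (t : Source d) :
    ℂ :=
  ∑ v, star (O t v fun _ => false) * preparedState O p v

/-- The two rotation angles are chosen such that the amplitude `⟨0|overlapCircuit|0⟩` runs from
`cos (5π/12)` to `cos (π/3)` as the overlap runs from `-1` to `1`. -/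
def overlapCircuit (p : Option (Source d)) (t : Source d) : List (Gate n d (n + 1)) :=
  .elem (oneQubit (rot (Real.pi / 24))) (wire 0) ∅ (by simp) ::
    (prepare p ++ [.unload t (dataReg n) {0} dataReg_notMem,
      .elem (oneQubit (rot (-(3 * Real.pi / 8)))) (wire 0) ∅ (by simp)])

theorem runCircuit_overlapCircuit (p : Option (Source d)) (t : Source d) :
    runCircuit O (overlapCircuit p t) (zeroKet (n + 1)) (fun _ => false) =
      Real.cos (3 * Real.pi / 8) * Real.cos (Real.pi / 24) +
        Real.sin (3 * Real.pi / 8) * Real.sin (Real.pi / 24) * overlap O p t := by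
  set ψ₁ := applyCtrl (oneQubit (rot (Real.pi / 24))).1 (wire 0) ∅ (zeroKet (n + 1)) with hψ₁
  have hzero : ∀ c b, zeroKet (n + 1) (bcons c b) =
      if c = false ∧ b = fun _ => false then 1 else 0 := fun c b => by
    rw [zeroKet, Pi.single_apply, ← bcons_false]
    refine if_congr ?_ rfl rfl
    exact Fin.cons_inj
  have h₁ : ∀ b, ψ₁ (bcons true b) =
      if b = fun _ => false then (Real.sin (Real.pi / 24) : ℂ) else 0 := fun b => by
    rw [hψ₁, applyCtrl_oneQubit]
    simp [bcons_zero, update_bcons_zero, hzero, rot]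
  have h₁' : ψ₁ (bcons false fun _ => false) = Real.cos (Real.pi / 24) := by
    rw [hψ₁, applyCtrl_oneQubit]
    simp [bcons_zero, update_bcons_zero, hzero, rot]
  have h₂ := runCircuit_prepare (O := O) p ψ₁ _ h₁
  set ψ₂ := runCircuit O (prepare p) ψ₁
  rw [overlapCircuit, runCircuit_cons, runCircuit_append]
  change applyCtrl (oneQubit (rot (-(3 * Real.pi / 8)))).1 (wire 0) ∅
    (applyCtrl (O t)ᴴ (dataReg n) {0} ψ₂) _ = _
  rw [applyCtrl_oneQubit, ← bcons_false]
  simp only [Finset.notMem_empty, false_imp_iff, implies_true, if_true, update_bcons_zero,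
    applyCtrl_dataReg_false, applyCtrl_dataReg_true, (h₂ _).1, (h₂ _).2, h₁']
  simp only [rot, of_apply, conjTranspose_apply, overlap, Real.cos_neg, Real.sin_neg, neg_neg,
    Finset.mul_sum, if_true, Bool.false_eq_true, if_false]
  rw [add_comm]
  congr 1
  exact Finset.sum_congr rfl fun v _ => by simp; ring

theorem gatesTime_overlapCircuit_le {T : ℝ} (hT : 1 ≤ T) (hn : (n : ℝ) ≤ T)
    (p : Option (Source d)) (t : Source d) :
    gatesTime T (overlapCircuit (n := n) p t) ≤ 6 * T := by
  have hp : gatesTime T (prepare (n := n) p) ≤ 2 * T := by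
    cases p with
    | some s =>
      simp [prepare, gatesTime, Gate.time]
      linarith
    | none =>
      simp [prepare, gatesTime, Function.comp_def, Gate.time]
      linarith
  rw [overlapCircuit, gatesTime_cons, gatesTime_append, gatesTime_cons, gatesTime_cons,
    gatesTime_nil]
  simp [Gate.time]
  linarith

end Overlap

/-! ### Amplitude amplification -/

section Grover

variable {n d q : ℕ} {O : Source d → Matrix (Bits n) (Bits n) ℂ}

/-- The circuit `c`, followed by `m` Grover iterations. -/
def grover (c : List (Gate n d (q + 1))) : ℕ → List (Gate n d (q + 1))
  | 0 => c
  | m + 1 => grover c m ++ (reflectZero n d q ++ (invCircuit c ++ (reflectZero n d q ++ c)))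

/-- In the plane spanned by `|0⟩` and `c|0⟩`, whose angle is `θ`, a Grover iteration is a rotation
by `2θ`. -/
theorem runCircuit_grover (hO : ∀ s, O s ∈ unitaryGroup (Bits n) ℂ)
    (c : List (Gate n d (q + 1))) (θ : ℝ)
    (hc : runCircuit O c (zeroKet (q + 1)) (fun _ => false) = Real.cos θ) (m : ℕ) :
    (Real.sin θ : ℂ) • runCircuit O (grover c m) (zeroKet (q + 1)) =
      (Real.sin ((2 * m + 1) * θ) : ℂ) • runCircuit O c (zeroKet (q + 1)) -
        (Real.sin (2 * m * θ) : ℂ) • zeroKet (q + 1) := by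
  induction m with
  | zero => simp [grover]
  | succ m ih =>
    set Ψ := runCircuit O c (zeroKet (q + 1)) with hΨ
    rw [grover, runCircuit_append, ← runCircuit_smul, ih]
    set x : ℂ := ((Real.sin ((2 * m + 1) * θ) : ℝ) : ℂ) with hx
    set y : ℂ := ((Real.sin (2 * m * θ) : ℝ) : ℂ) with hy
    set C : ℂ := ((Real.cos θ : ℝ) : ℂ) with hC
    have hinv0 : runCircuit O (invCircuit c) (zeroKet (q + 1)) (fun _ => false) = C := by
      rw [runCircuit_inv_zeroKet, ← hΨ, hc, hC]
      exact Complex.conj_ofReal _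
    have hrefl : ∀ χ, runCircuit O (invCircuit c ++ (reflectZero n d q ++ c)) χ =
        χ - (2 * runCircuit O (invCircuit c) χ fun _ => false) • Ψ := fun χ => by
      have hcc : runCircuit O c (runCircuit O (invCircuit c) χ) = χ := by
        have : invCircuit (invCircuit c) = c := by
          simp only [invCircuit, List.map_reverse, List.reverse_reverse, List.map_map]
          refine (List.map_congr_left fun g _ => ?_).trans (List.map_id c)
          cases g <;> simp [Gate.inv]
        simpa only [this] using runCircuit_inv_runCircuit hO (invCircuit c) χ
      rw [runCircuit_append, runCircuit_append, runCircuit_reflectZero, sub_eq_add_neg,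
        ← neg_smul, runCircuit_add, runCircuit_smul, hcc, hΨ, neg_smul, ← sub_eq_add_neg]
    have hlin : ∀ u v : ℂ, runCircuit O (invCircuit c) (u • Ψ + v • zeroKet (q + 1))
        (fun _ => false) = u + v * C := fun u v => by
      rw [runCircuit_add, runCircuit_smul, runCircuit_smul, hΨ, runCircuit_inv_runCircuit hO,
        Pi.add_apply, Pi.smul_apply, Pi.smul_apply, hinv0, zeroKet_zero]
      simp
    have hval : (x • Ψ - y • zeroKet (q + 1)) (fun _ => false) = x * C - y := by
      rw [Pi.sub_apply, Pi.smul_apply, Pi.smul_apply, hc, zeroKet_zero]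
      simp [hC]
    have hS : x • Ψ - y • zeroKet (q + 1) - (2 * (x * C - y)) • zeroKet (q + 1) =
        x • Ψ + (y - 2 * (x * C)) • zeroKet (q + 1) := by module
    rw [runCircuit_append, runCircuit_reflectZero, hval, hS, hrefl, hlin]
    have e1 : (Real.sin (2 * (m + 1 : ℕ) * θ) : ℂ) = 2 * (x * C) - y := by
      rw [hx, hy, hC]
      norm_cast
      have a1 : 2 * ((m + 1 : ℕ) : ℝ) * θ = (2 * m + 1) * θ + θ := by push_cast; ring
      have a2 : 2 * (m : ℝ) * θ = (2 * m + 1) * θ - θ := by ring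
      push_cast at a1 a2 ⊢
      rw [a1, a2, Real.sin_add, Real.sin_sub]
      ring
    have e2 : (Real.sin ((2 * (m + 1 : ℕ) + 1) * θ) : ℂ) =
        2 * C * Real.sin (2 * (m + 1 : ℕ) * θ) - x := by
      rw [hx, hC]
      norm_cast
      have a1 : (2 * ((m + 1 : ℕ) : ℝ) + 1) * θ = 2 * (m + 1 : ℕ) * θ + θ := by ring
      have a2 : (2 * (m : ℝ) + 1) * θ = 2 * (m + 1 : ℕ) * θ - θ := by push_cast; ring
      push_cast at a1 a2 ⊢
      rw [a1, a2, Real.sin_add, Real.sin_sub]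
      ring
    rw [e2, e1]
    module

theorem norm_sq_finalState_grover (hO : ∀ s, O s ∈ unitaryGroup (Bits n) ℂ)
    (c : List (Gate n d (q + 1))) (θ : ℝ) (hθ : Real.sin θ ≠ 0)
    (hc : runCircuit O c (zeroKet (q + 1)) (fun _ => false) = Real.cos θ) (m : ℕ) :
    ‖finalState O (grover c m) (fun _ => false)‖ ^ 2 = Real.cos ((2 * m + 1) * θ) ^ 2 := by
  have h := congrFun (runCircuit_grover hO c θ hc m) fun _ => false
  rw [Pi.sub_apply, Pi.smul_apply, Pi.smul_apply, Pi.smul_apply, hc, zeroKet_zero] at h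
  have ht : 2 * (m : ℝ) * θ = (2 * m + 1) * θ - θ := by ring
  rw [ht, Real.sin_sub] at h
  have h' : runCircuit O (grover c m) (zeroKet (q + 1)) (fun _ => false) =
      (Real.cos ((2 * m + 1) * θ) : ℝ) := by
    have hθ' : (Real.sin θ : ℂ) ≠ 0 := by exact_mod_cast hθ
    refine mul_left_cancel₀ hθ' ?_
    rw [smul_eq_mul] at h
    rw [h]
    simp only [smul_eq_mul]
    push_cast
    ring
  change ‖runCircuit O (grover c m) (zeroKet (q + 1)) (fun _ => false)‖ ^ 2 = _
  rw [h', Complex.norm_real, Real.norm_eq_abs, sq_abs]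

theorem gatesTime_grover (T : ℝ) (c : List (Gate n d (q + 1))) (m : ℕ) :
    gatesTime T (grover c m) = gatesTime T c + m * (6 * (q + 1) + 2 * gatesTime T c) := by
  induction m with
  | zero => simp [grover]
  | succ m ih =>
    simp only [grover, gatesTime_append, ih, gatesTime_inv, gatesTime_reflectZero]
    push_cast
    ring

end Grover

/-! ### Repeated runs of circuits -/

section Sampling

variable {n d q : ℕ} {O : Source d → Matrix (Bits n) (Bits n) ℂ} {nrm : Source d → ℝ}
  {E : Set (Fin d → ℝ)}

/-- Run the circuit `c` `s` times and count the outcomes `0…0`, starting the count from `k`; then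
continue with `next`, according to the count. -/
def sample (c : List (Gate n d q)) : ℕ → ℕ → (ℕ → Algo n d) → Algo n d
  | 0, k, next => next k
  | s + 1, k, next =>
    .run q c fun b => sample c s (if b = fun _ => false then k + 1 else k) next

theorem Algo.prob_nonneg (A : Algo n d) : 0 ≤ A.prob O nrm E := by
  induction A with
  | output w => unfold Algo.prob; split_ifs <;> norm_num
  | readNorm s next ih => exact ih _
  | run q c next ih => exact Finset.sum_nonneg fun b _ => mul_nonneg (sq_nonneg _) (ih b)

/-- A run after which only the outcome `0…0` is told from the others is a coin toss. -/
theorem prob_run_ite (hO : ∀ s, O s ∈ unitaryGroup (Bits n) ℂ) (c : List (Gate n d q))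
    (A B : Algo n d) :
    (Algo.run q c fun b => if b = fun _ => false then A else B).prob O nrm E =
      ‖finalState O c fun _ => false‖ ^ 2 * A.prob O nrm E +
        (1 - ‖finalState O c fun _ => false‖ ^ 2) * B.prob O nrm E := by
  have h := sum_norm_sq_finalState hO c
  rw [← Finset.add_sum_erase _ _ (Finset.mem_univ fun _ => false)] at h
  rw [Algo.prob, ← Finset.add_sum_erase _ _ (Finset.mem_univ fun _ => false), if_pos rfl,
    ← eq_sub_iff_add_eq'.2 h, Finset.sum_mul]
  congr 1
  exact Finset.sum_congr rfl fun b hb => by rw [if_neg (Finset.ne_of_mem_erase hb)]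

theorem prob_sample_succ (hO : ∀ s, O s ∈ unitaryGroup (Bits n) ℂ) (c : List (Gate n d q))
    (s k : ℕ) (next : ℕ → Algo n d) :
    (sample c (s + 1) k next).prob O nrm E =
      ‖finalState O c fun _ => false‖ ^ 2 * (sample c s (k + 1) next).prob O nrm E +
        (1 - ‖finalState O c fun _ => false‖ ^ 2) * (sample c s k next).prob O nrm E := by
  rw [← prob_run_ite hO]
  congr 1
  unfold sample
  congr 1
  funext b
  split_ifs <;> cases s <;> rfl

theorem norm_sq_finalState_zero_le_one (hO : ∀ s, O s ∈ unitaryGroup (Bits n) ℂ)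
    (c : List (Gate n d q)) : ‖finalState O c fun _ => false‖ ^ 2 ≤ 1 := by
  rw [← sum_norm_sq_finalState hO c]
  exact Finset.single_le_sum (f := fun b => ‖finalState O c b‖ ^ 2) (fun b _ => sq_nonneg _)
    (Finset.mem_univ _)

theorem le_prob_sample_of_forall (hO : ∀ s, O s ∈ unitaryGroup (Bits n) ℂ)
    (c : List (Gate n d q)) {B : ℝ} {next : ℕ → Algo n d}
    (h : ∀ t, B ≤ (next t).prob O nrm E) (s k : ℕ) :
    B ≤ (sample c s k next).prob O nrm E := by
  induction s generalizing k with
  | zero => exact h k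
  | succ s ih =>
    rw [prob_sample_succ hO]
    nlinarith [ih k, ih (k + 1), norm_sq_finalState_zero_le_one hO c,
      sq_nonneg ‖finalState O c fun _ => false‖]

/-- The moment generating function of a centred Bernoulli variable. -/
theorem bernoulli_mgf_le {p l : ℝ} (hp0 : 0 ≤ p) (hp1 : p ≤ 1) (hl : |l| ≤ 1) :
    p * Real.exp (l * (1 - p)) + (1 - p) * Real.exp (-(l * p)) ≤ Real.exp (l ^ 2 / 4) := by
  have hx : ∀ x : ℝ, |x| ≤ 1 → Real.exp x ≤ 1 + x + x ^ 2 := fun x hx => by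
    have := (abs_le.1 (Real.abs_exp_sub_one_sub_id_le hx)).2
    linarith
  have h1 := hx (l * (1 - p)) (by
    rw [abs_mul, abs_of_nonneg (sub_nonneg.2 hp1)]
    nlinarith [abs_nonneg l])
  have h2 := hx (-(l * p)) (by
    rw [abs_neg, abs_mul, abs_of_nonneg hp0]
    nlinarith [abs_nonneg l])
  have h3 := Real.add_one_le_exp (l ^ 2 / 4)
  have h4 : p * (1 + l * (1 - p) + (l * (1 - p)) ^ 2) +
      (1 - p) * (1 + -(l * p) + (-(l * p)) ^ 2) = 1 + l ^ 2 * (p * (1 - p)) := by ring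
  have h5 : l ^ 2 * (p * (1 - p)) ≤ l ^ 2 / 4 := by
    nlinarith [mul_nonneg (sq_nonneg l) (sq_nonneg (p - 1 / 2))]
  nlinarith [mul_le_mul_of_nonneg_left h1 hp0, mul_le_mul_of_nonneg_left h2 (sub_nonneg.2 hp1)]

/-- The Chernoff bound, by backward induction on the number `s` of the remaining runs; `x` is the
deviation of the count from its mean in the past runs. -/
theorem le_prob_sample_aux (hO : ∀ s, O s ∈ unitaryGroup (Bits n) ℂ)
    (c : List (Gate n d q)) {p l r B : ℝ} (hp : ‖finalState O c fun _ => false‖ ^ 2 = p)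
    (hl0 : 0 ≤ l) (hl1 : l ≤ 1) (hB : B ≤ 1) {next : ℕ → Algo n d} (s k : ℕ) (x : ℝ)
    (h : ∀ t : ℕ, |x + (t - k) - p * s| ≤ r → B ≤ (next t).prob O nrm E) :
    B - (Real.exp (l * (x - r)) + Real.exp (l * (-x - r))) * Real.exp (l ^ 2 / 4) ^ s ≤
      (sample c s k next).prob O nrm E := by
  have hp0 : 0 ≤ p := hp ▸ sq_nonneg _
  have hp1 : p ≤ 1 := hp ▸ norm_sq_finalState_zero_le_one hO c
  induction s generalizing k x with
  | zero =>
    rw [pow_zero, mul_one, sample]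
    by_cases hx : |x| ≤ r
    · have := h k (by simpa using hx)
      linarith [Real.exp_pos (l * (x - r)), Real.exp_pos (l * (-x - r))]
    · have h0 := (next k).prob_nonneg (O := O) (nrm := nrm) (E := E)
      have h1 : 1 ≤ Real.exp (l * (x - r)) + Real.exp (l * (-x - r)) := by
        rcases lt_abs.1 (not_le.1 hx) with hx | hx
        · linarith [Real.one_le_exp (mul_nonneg hl0 (sub_nonneg.2 hx.le)),
            Real.exp_pos (l * (-x - r))]
        · linarith [Real.one_le_exp (mul_nonneg hl0 (sub_nonneg.2 hx.le)),
            Real.exp_pos (l * (x - r))]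
      linarith
  | succ s ih =>
    have h1 := ih (k + 1) (x + (1 - p)) fun t ht => h t (by
      convert ht using 2; push_cast; ring)
    have h0 := ih k (x - p) fun t ht => h t (by
      convert ht using 2; push_cast; ring)
    rw [prob_sample_succ hO, hp]
    set P := Real.exp (l * (x - r))
    set Q := Real.exp (l * (-x - r))
    set M := Real.exp (l ^ 2 / 4)
    have e1 : Real.exp (l * (x + (1 - p) - r)) = P * Real.exp (l * (1 - p)) := by
      rw [← Real.exp_add]; ring_nf
    have e2 : Real.exp (l * (-(x + (1 - p)) - r)) = Q * Real.exp (-l * (1 - p)) := by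
      rw [← Real.exp_add]; ring_nf
    have e3 : Real.exp (l * (x - p - r)) = P * Real.exp (-(l * p)) := by
      rw [← Real.exp_add]; ring_nf
    have e4 : Real.exp (l * (-(x - p) - r)) = Q * Real.exp (-(-l * p)) := by
      rw [← Real.exp_add]; ring_nf
    have m1 := bernoulli_mgf_le hp0 hp1 (l := l) (by rwa [abs_of_nonneg hl0])
    have m2 := bernoulli_mgf_le hp0 hp1 (l := -l) (by rwa [abs_neg, abs_of_nonneg hl0])
    rw [neg_sq] at m2
    rw [e1, e2] at h1
    rw [e3, e4] at h0
    have hM : 0 ≤ M ^ s := pow_nonneg (Real.exp_pos _).le s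
    have hPM : 0 ≤ P * M ^ s := mul_nonneg (Real.exp_pos _).le hM
    have hQM : 0 ≤ Q * M ^ s := mul_nonneg (Real.exp_pos _).le hM
    have g1 := mul_le_mul_of_nonneg_left h1 hp0
    have g0 := mul_le_mul_of_nonneg_left h0 (sub_nonneg.2 hp1)
    have k1 := mul_le_mul_of_nonneg_left m1 hPM
    have k2 := mul_le_mul_of_nonneg_left m2 hQM
    rw [pow_succ]
    linarith

theorem le_prob_sample (hO : ∀ s, O s ∈ unitaryGroup (Bits n) ℂ)
    (c : List (Gate n d q)) {p τ B : ℝ} (hp : ‖finalState O c fun _ => false‖ ^ 2 = p)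
    (hτ0 : 0 ≤ τ) (hτ1 : τ ≤ 1 / 2) (hB : B ≤ 1) {next : ℕ → Algo n d} (s : ℕ)
    (h : ∀ t : ℕ, |t - p * s| ≤ τ * s → B ≤ (next t).prob O nrm E) :
    B - 2 * Real.exp (-(τ ^ 2 * s)) ≤ (sample c s 0 next).prob O nrm E := by
  have := le_prob_sample_aux (nrm := nrm) (E := E) hO c (l := 2 * τ) (r := τ * s) hp
    (by linarith) (by linarith) hB s 0 0 (by simpa using h)
  refine le_trans (le_of_eq ?_) this
  rw [← Real.exp_nat_mul, neg_zero, ← two_mul, mul_assoc, ← Real.exp_add]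
  ring_nf

theorem sample_runsWithin {T t₀ : ℝ} (c : List (Gate n d q)) {next : ℕ → Algo n d}
    (h : ∀ k, (next k).RunsWithin T nrm t₀) (s k : ℕ) (t : ℝ)
    (ht : t = t₀ + s * (q + gatesTime T c)) : (sample c s k next).RunsWithin T nrm t := by
  induction s generalizing k t with
  | zero =>
    have : t = t₀ := by simpa using ht
    exact this ▸ h k
  | succ s ih =>
    intro b
    refine ih _ _ ?_
    rw [ht, gatesTime]
    push_cast
    ring

end Sampling

section MeasureAll

variable {n d q : ℕ} {ι : Type*} [DecidableEq ι]
  {O : Source d → Matrix (Bits n) (Bits n) ℂ} {nrm : Source d → ℝ} {E : Set (Fin d → ℝ)}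

/-- For each index in a list, run the circuit `circ i` `shots i` times and record how often the
outcome is `0…0`; then compute the output from this record. -/
def measureAll (circ : ι → List (Gate n d q)) (shots : ι → ℕ) (out : (ι → ℕ) → Fin d → ℝ) :
    List ι → (ι → ℕ) → Algo n d
  | [], r => .output (out r)
  | i :: l, r => sample (circ i) (shots i) 0 fun t =>
      measureAll circ shots out l (Function.update r i t)

theorem measureAll_runsWithin {T t₀ : ℝ} (ht₀ : 0 ≤ t₀) (circ : ι → List (Gate n d q))
    (shots : ι → ℕ) (out : (ι → ℕ) → Fin d → ℝ) (l : List ι) (r : ι → ℕ) :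
    (measureAll circ shots out l r).RunsWithin T nrm
      (t₀ + (l.map fun i => shots i * (q + gatesTime T (circ i))).sum) := by
  induction l generalizing r with
  | nil => simpa [measureAll, Algo.RunsWithin] using ht₀
  | cons i l ih =>
    refine sample_runsWithin _ (fun k => ih _) _ _ _ ?_
    rw [List.map_cons, List.sum_cons]
    ring

/-- The union bound: if the record of each index in `S` is accurate up to probability `fail i`,
then an event that accurate records for the indices in `S` guarantee is as likely as the total
failure probability permits. The records of the other indices do not matter. -/
theorem le_prob_measureAll (hO : ∀ s, O s ∈ unitaryGroup (Bits n) ℂ)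
    (circ : ι → List (Gate n d q)) (shots : ι → ℕ) (out : (ι → ℕ) → Fin d → ℝ)
    (S : Set ι) [DecidablePred (· ∈ S)] {τ : ℝ} (hτ0 : 0 ≤ τ) (hτ1 : τ ≤ 1 / 2)
    (l : List ι) (hl : l.Nodup) (r : ι → ℕ)
    (h : ∀ r' : ι → ℕ, (∀ i ∉ l, r' i = r i) →
      (∀ i ∈ l, i ∈ S → |r' i - ‖finalState O (circ i) fun _ => false‖ ^ 2 * shots i| ≤
        τ * shots i) → out r' ∈ E) :
    1 - (l.map fun i => if i ∈ S then 2 * Real.exp (-(τ ^ 2 * shots i)) else 0).sum ≤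
      (measureAll circ shots out l r).prob O nrm E := by
  induction l generalizing r with
  | nil =>
    rw [measureAll, Algo.prob, if_pos (h r (fun _ _ => rfl) (by simp))]
    simp
  | cons i l ih =>
    obtain ⟨hi, hl⟩ := List.nodup_cons.1 hl
    have hrest : ∀ t : ℕ, (i ∈ S → |t - ‖finalState O (circ i) fun _ => false‖ ^ 2 * shots i| ≤
        τ * shots i) →
        1 - (l.map fun i => if i ∈ S then 2 * Real.exp (-(τ ^ 2 * shots i)) else 0).sum ≤
          (measureAll circ shots out l (Function.update r i t)).prob O nrm E := by
      refine fun t ht => ih hl _ fun r' hr' hacc => h r' (fun j hj => ?_) fun j hj hjS => ?_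
      · rw [List.mem_cons, not_or] at hj
        rw [hr' j hj.2, Function.update_of_ne hj.1]
      · rcases List.mem_cons.1 hj with rfl | hj
        · rw [hr' j hi, Function.update_self]
          exact ht hjS
        · exact hacc j hj hjS
    rw [List.map_cons, List.sum_cons, measureAll]
    by_cases hS : i ∈ S
    · rw [if_pos hS]
      have hB : 1 - (l.map fun i =>
          if i ∈ S then 2 * Real.exp (-(τ ^ 2 * shots i)) else 0).sum ≤ 1 := by
        refine sub_le_self _ (List.sum_nonneg fun x hx => ?_)
        obtain ⟨j, -, rfl⟩ := List.mem_map.1 hx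
        split_ifs <;> positivity
      have := le_prob_sample (nrm := nrm) (E := E) hO (circ i) rfl hτ0 hτ1 hB (shots i)
        fun t ht => hrest t fun _ => ht
      linarith
    · rw [if_neg hS, zero_add]
      exact le_prob_sample_of_forall hO (circ i) (fun t => hrest t fun h => absurd h hS) _ _

end MeasureAll

/-! ### Angles from cosines of their multiples -/

section Angle

open Real

/-- If `θ` and `θ'` are close enough for the multiples `kθ`, `kθ'` not to be confused, then the
squared cosines of `kθ` and `(k+2)θ` together determine `θ` with an error of order `1/k`: as
`cos² kθ - cos² kθ' = -sin (k(θ+θ')) sin (k(θ-θ'))`, the only danger is that `sin (k(θ+θ'))`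
is small, and it is not small both for `k` and for `k+2`, since `sin (2(θ+θ'))` is not. -/
theorem angle_close {k θ θ' : ℝ} (hk : 0 < k) (hθ : θ ∈ Set.Icc (π / 3) (5 * π / 12))
    (hθ' : θ' ∈ Set.Icc (π / 3) (5 * π / 12)) (hsep : (k + 2) * |θ - θ'| ≤ π / 2)
    (h1 : |cos (k * θ) ^ 2 - cos (k * θ') ^ 2| ≤ 1 / 12)
    (h2 : |cos ((k + 2) * θ) ^ 2 - cos ((k + 2) * θ') ^ 2| ≤ 1 / 12) :
    k * |θ - θ'| ≤ 7 * π / 72 := by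
  have hsub : ∀ x y : ℝ, cos x ^ 2 - cos y ^ 2 = -(sin (x + y) * sin (x - y)) := fun x y => by
    rw [sin_add, sin_sub, cos_sq', cos_sq']
    linear_combination sin x ^ 2 * sin_sq_add_cos_sq y - sin y ^ 2 * sin_sq_add_cos_sq x
  have hD := abs_nonneg (θ - θ')
  have hsin : ∀ j : ℝ, k ≤ j → j ≤ k + 2 → 2 / π * (k * |θ - θ'|) ≤ |sin (j * θ - j * θ')| := by
    intro j hkj hj
    have habs : |j * θ - j * θ'| = j * |θ - θ'| := by
      rw [← mul_sub, abs_mul, abs_of_pos (hk.trans_le hkj)]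
    have hle : j * |θ - θ'| ≤ π / 2 := le_trans (mul_le_mul_of_nonneg_right hj hD) hsep
    have := mul_abs_le_abs_sin (x := j * θ - j * θ') (by rwa [habs])
    rw [habs] at this
    refine le_trans ?_ this
    gcongr
  have hS : 6 / 7 ≤ |sin (2 * (θ + θ'))| := by
    have e : sin (2 * (θ + θ')) = -cos (|2 * (θ + θ') - 3 * π / 2|) := by
      rw [cos_abs, show 2 * (θ + θ') - 3 * π / 2 = 2 * (θ + θ') + π / 2 - 2 * π by ring,
        cos_sub_two_pi, cos_add_pi_div_two, neg_neg]
    have hle : |2 * (θ + θ') - 3 * π / 2| ≤ π / 6 := by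
      rw [abs_le]
      constructor <;> linarith [hθ.1, hθ.2, hθ'.1, hθ'.2]
    have hcos := cos_le_cos_of_nonneg_of_le_pi (abs_nonneg _) (by linarith [pi_pos]) hle
    rw [cos_pi_div_six] at hcos
    have h3 : (12 / 7 : ℝ) ≤ √3 := le_sqrt_of_sq_le (by norm_num)
    rw [e, abs_neg]
    exact le_trans (by linarith) (le_abs_self _)
  have hsplit : |sin (2 * (θ + θ'))| ≤
      |sin ((k + 2) * θ + (k + 2) * θ')| + |sin (k * θ + k * θ')| := by
    rw [show 2 * (θ + θ') = ((k + 2) * θ + (k + 2) * θ') - (k * θ + k * θ') by ring,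
      sin_sub]
    refine (abs_sub _ _).trans (add_le_add ?_ ?_)
    · rw [abs_mul]
      exact mul_le_of_le_one_right (abs_nonneg _) (abs_cos_le_one _)
    · rw [abs_mul]
      exact mul_le_of_le_one_left (abs_nonneg _) (abs_cos_le_one _)
  rw [hsub, abs_neg, abs_mul] at h1 h2
  set u := 2 / π * (k * |θ - θ'|) with hu
  have hu0 : 0 ≤ u := by positivity
  have g1 := (mul_le_mul_of_nonneg_left (hsin k le_rfl (by linarith))
    (abs_nonneg (sin (k * θ + k * θ')))).trans h1
  have g2 := (mul_le_mul_of_nonneg_left (hsin (k + 2) (by linarith) le_rfl)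
    (abs_nonneg (sin ((k + 2) * θ + (k + 2) * θ')))).trans h2
  have hfin : u ≤ 7 / 36 := by nlinarith
  have hku : k * |θ - θ'| = π / 2 * u := by
    rw [hu]; field_simp
  rw [hku]
  nlinarith [pi_pos]

/-- Angles that agree on the levels `0, …, K` have distance `O(2⁻ᴷ)`. -/
theorem angle_close_of_levels {θ θ' : ℝ} (hθ : θ ∈ Set.Icc (π / 3) (5 * π / 12))
    (hθ' : θ' ∈ Set.Icc (π / 3) (5 * π / 12)) (K : ℕ)
    (h1 : ∀ i ≤ K, |cos ((2 * (2 ^ i - 1) + 1) * θ) ^ 2 -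
      cos ((2 * (2 ^ i - 1) + 1) * θ') ^ 2| ≤ 1 / 12)
    (h2 : ∀ i ≤ K, |cos ((2 * 2 ^ i + 1) * θ) ^ 2 - cos ((2 * 2 ^ i + 1) * θ') ^ 2| ≤ 1 / 12) :
    (2 * (2 ^ K - 1) + 1) * |θ - θ'| ≤ 7 * π / 72 := by
  induction K with
  | zero =>
    refine angle_close (by norm_num) hθ hθ' ?_ (h1 0 le_rfl) ?_
    · have : |θ - θ'| ≤ π / 12 := by
        rw [abs_le]
        constructor <;> linarith [hθ.1, hθ.2, hθ'.1, hθ'.2]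
      norm_num
      linarith [pi_pos]
    · have := h2 0 le_rfl
      norm_num at this ⊢
      exact this
  | succ K ih =>
    have hK := ih (fun i hi => h1 i (by lia)) fun i hi => h2 i (by lia)
    have h2K : (1 : ℝ) ≤ 2 ^ K := one_le_pow₀ (by norm_num)
    refine angle_close ?_ hθ hθ' ?_ (h1 _ le_rfl) ?_
    · rw [pow_succ]; linarith
    · rw [pow_succ]
      nlinarith [abs_nonneg (θ - θ'), pi_pos]
    · convert h2 _ le_rfl using 5 <;> ring

/-- The amplitude that the overlap circuit turns an overlap `a` into. -/
def windowAmp (a : ℝ) : ℝ :=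
  cos (3 * π / 8) * cos (π / 24) + sin (3 * π / 8) * sin (π / 24) * a

/-- The angle whose cosine is `windowAmp a`. -/
def windowAngle (a : ℝ) : ℝ := arccos (windowAmp a)

theorem windowAmp_eq (a : ℝ) : windowAmp a =
    (1 + a) / 2 * cos (π / 3) + (1 - a) / 2 * cos (5 * π / 12) := by
  rw [show π / 3 = 3 * π / 8 - π / 24 by ring, show 5 * π / 12 = 3 * π / 8 + π / 24 by ring,
    cos_sub, cos_add, windowAmp]
  ring

theorem cos_five_pi_div_twelve_bounds : 0 ≤ cos (5 * π / 12) ∧ cos (5 * π / 12) ≤ 3 / 10 := by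
  rw [show 5 * π / 12 = π / 2 - π / 12 by ring, cos_pi_div_two_sub]
  refine ⟨(sin_pos_of_pos_of_lt_pi (by positivity) (by linarith [pi_pos])).le, ?_⟩
  refine (sin_le (by positivity)).trans ?_
  linarith [pi_lt_d2]

theorem windowAmp_mem {a : ℝ} (ha : |a| ≤ 1) :
    windowAmp a ∈ Set.Icc (cos (5 * π / 12)) (cos (π / 3)) := by
  have ⟨h1, h2⟩ := abs_le.1 ha
  have := cos_five_pi_div_twelve_bounds.2
  rw [windowAmp_eq, cos_pi_div_three]
  constructor <;> nlinarith

theorem cos_windowAngle {a : ℝ} (ha : |a| ≤ 1) : cos (windowAngle a) = windowAmp a := by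
  have ⟨h1, h2⟩ := windowAmp_mem ha
  have := cos_five_pi_div_twelve_bounds.1
  rw [cos_pi_div_three] at h2
  exact cos_arccos (by linarith) (by linarith)

theorem windowAngle_mem {a : ℝ} (ha : |a| ≤ 1) :
    windowAngle a ∈ Set.Icc (π / 3) (5 * π / 12) := by
  have ⟨h1, h2⟩ := windowAmp_mem ha
  constructor
  · rw [← arccos_cos (x := π / 3) (by positivity) (by linarith [pi_pos])]
    exact antitone_arccos h2
  · rw [← arccos_cos (x := 5 * π / 12) (by positivity) (by linarith [pi_pos])]
    exact antitone_arccos h1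

theorem abs_sub_le_of_windowAngle {a a' : ℝ} (ha : |a| ≤ 1) (ha' : |a'| ≤ 1) :
    |a - a'| ≤ 10 * |windowAngle a - windowAngle a'| := by
  have h : |windowAmp a - windowAmp a'| ≤ |windowAngle a - windowAngle a'| := by
    rw [← cos_windowAngle ha, ← cos_windowAngle ha']
    exact abs_cos_sub_cos_le _ _
  have e : windowAmp a - windowAmp a' = (cos (π / 3) - cos (5 * π / 12)) / 2 * (a - a') := by
    rw [windowAmp_eq, windowAmp_eq]
    ring
  have := cos_five_pi_div_twelve_bounds.2
  rw [e, cos_pi_div_three, abs_mul, abs_of_nonneg (by linarith)] at h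
  nlinarith [abs_nonneg (a - a')]

/-- The overlap `a` is consistent with the observed frequencies `f i v` of the outcome `0…0`
after `2 ^ i - 1` (for `v = false`) and after `2 ^ i` (for `v = true`) Grover iterations. -/
def Consistent {K : ℕ} (f : Fin K → Bool → ℝ) (a : ℝ) : Prop :=
  |a| ≤ 1 ∧ ∀ i v, |f i v - cos ((2 * (2 ^ (i : ℕ) - if v then 0 else 1) + 1) *
    windowAngle a) ^ 2| ≤ 1 / 24

open Classical in
/-- Some overlap that is consistent with the observed frequencies, if there is one. -/
def estimate {K : ℕ} (f : Fin K → Bool → ℝ) : ℝ :=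
  if h : ∃ a, Consistent f a then h.choose else 0

theorem abs_estimate_le_one {K : ℕ} (f : Fin K → Bool → ℝ) : |estimate f| ≤ 1 := by
  unfold estimate
  split_ifs with h
  · exact h.choose_spec.1
  · simp

theorem abs_estimate_sub_le {K : ℕ} (hK : 0 < K) {f : Fin K → Bool → ℝ} {a : ℝ}
    (h : Consistent f a) : |estimate f - a| ≤ 7 / 2 ^ K := by
  have hex : ∃ a, Consistent f a := ⟨a, h⟩
  have h' : Consistent f (estimate f) := by
    rw [estimate, dif_pos hex]
    exact hex.choose_spec
  obtain ⟨L, rfl⟩ : ∃ L, K = L + 1 := ⟨K - 1, by lia⟩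
  have hclose := angle_close_of_levels (windowAngle_mem h'.1) (windowAngle_mem h.1) L
    (fun i hi => by
      have a1 := h.2 ⟨i, by lia⟩ false
      have a2 := h'.2 ⟨i, by lia⟩ false
      simp only [Bool.false_eq_true, if_false] at a1 a2
      rw [abs_le] at a1 a2 ⊢
      constructor <;> linarith)
    (fun i hi => by
      have a1 := h.2 ⟨i, by lia⟩ true
      have a2 := h'.2 ⟨i, by lia⟩ true
      simp only [if_true, sub_zero] at a1 a2
      rw [abs_le] at a1 a2 ⊢
      constructor <;> linarith)
  refine (abs_sub_le_of_windowAngle h'.1 h.1).trans ?_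
  set D := |windowAngle (estimate f) - windowAngle a|
  have hD : 0 ≤ D := abs_nonneg _
  have h2L : (1 : ℝ) ≤ 2 ^ L := one_le_pow₀ (by norm_num)
  rw [le_div_iff₀ (by positivity), pow_succ]
  nlinarith [pi_lt_d2]

end Angle

/-! ### Stability of the correlation formula -/

section Perturbation

open Real

theorem abs_sqrt_div_sqrt_sub_one_le {u u' g m : ℝ} (hu : 0 ≤ u) (hm : 0 < m) (hu' : m ≤ u')
    (h : |u - u'| ≤ g) : |√u / √u' - 1| ≤ g / m := by
  have hs : 0 < √u' := sqrt_pos.2 (hm.trans_le hu')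
  have h1 : √u / √u' - 1 = (u - u') / (√u' * (√u + √u')) := by
    have e : u - u' = (√u - √u') * (√u + √u') := by
      nth_rw 1 [← sq_sqrt hu, ← sq_sqrt (hm.le.trans hu')]
      ring
    have : √u + √u' ≠ 0 := by positivity
    rw [e]
    field_simp
  have h2 : m ≤ √u' * (√u + √u') := by
    nlinarith [sq_sqrt (hm.le.trans hu'), mul_nonneg hs.le (sqrt_nonneg u)]
  rw [h1, abs_div, abs_of_pos (hm.trans_le h2)]
  have := abs_nonneg (u - u')
  gcongr
  linarith

/-- Stability of `(a - b c) / √((1 - b²)(1 - c²))` under errors that are small compared with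
`1 - b²` and `1 - c²`. -/
theorem abs_correlation_sub_le {a b c a' b' c' e η ε : ℝ} (hη : 0 < η) (hε : ε ≤ 1)
    (he : 4 * (e * η) ≤ ε) (ha : |a' - a| ≤ e) (hb : |b' - b| ≤ e) (hc : |c' - c| ≤ e)
    (hb1 : |b| ≤ 1) (hc1 : |c| ≤ 1) (hb2 : |b'| ≤ 2)
    (hc2 : |c'| ≤ 2) (hbη : 7 / η ≤ 1 - b ^ 2) (hcη : 7 / η ≤ 1 - c ^ 2)
    (hw : |(a - b * c) / (√(1 - b ^ 2) * √(1 - c ^ 2))| ≤ 1) :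
    |(a' - b' * c') / (√(1 - b' ^ 2) * √(1 - c' ^ 2)) -
      (a - b * c) / (√(1 - b ^ 2) * √(1 - c ^ 2))| ≤ ε := by
  have he0 : 0 ≤ e := (abs_nonneg _).trans ha
  have hsq : ∀ x x' : ℝ, |x' - x| ≤ e → |x| ≤ 1 → |x'| ≤ 2 →
      |(1 - x ^ 2) - (1 - x' ^ 2)| ≤ 3 * e := by
    intro x x' h h1 h2
    rw [show (1 - x ^ 2) - (1 - x' ^ 2) = (x' + x) * (x' - x) by ring, abs_mul]
    have := abs_add_le x' x
    exact mul_le_mul (by linarith) h (abs_nonneg _) (by norm_num)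
  have hlow : ∀ u u' : ℝ, |u - u'| ≤ 3 * e → 7 / η ≤ u → 6 / η ≤ u' := by
    intro u u' h hu
    have h3 : 3 * e ≤ 1 / η := by
      rw [le_div_iff₀ hη]
      linarith [mul_nonneg he0 hη.le]
    have := (abs_le.1 h).2
    have e7 : 7 / η = 6 / η + 1 / η := by ring
    linarith
  have h6 : 0 < 6 / η := by positivity
  have hdb := hsq b b' hb hb1 hb2
  have hdc := hsq c c' hc hc1 hc2
  have hb6 := hlow _ _ hdb hbη
  have hc6 := hlow _ _ hdc hcη
  have hbu : 0 ≤ 1 - b ^ 2 := le_trans (by positivity) hbη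
  have hcu : 0 ≤ 1 - c ^ 2 := le_trans (by positivity) hcη
  have rb := abs_sqrt_div_sqrt_sub_one_le hbu h6 hb6 hdb
  have rc := abs_sqrt_div_sqrt_sub_one_le hcu h6 hc6 hdc
  have hx : 3 * e / (6 / η) = e * η / 2 := by field_simp; ring
  rw [hx] at rb rc
  have hbpos : 0 < √(1 - b ^ 2) := sqrt_pos.2 (lt_of_lt_of_le (by positivity) hbη)
  have hcpos : 0 < √(1 - c ^ 2) := sqrt_pos.2 (lt_of_lt_of_le (by positivity) hcη)
  have hb'pos : 0 < √(1 - b' ^ 2) := sqrt_pos.2 (h6.trans_le hb6)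
  have hc'pos : 0 < √(1 - c' ^ 2) := sqrt_pos.2 (h6.trans_le hc6)
  set w := (a - b * c) / (√(1 - b ^ 2) * √(1 - c ^ 2)) with hwdef
  set ρ := √(1 - b ^ 2) / √(1 - b' ^ 2) with hρ
  set σ := √(1 - c ^ 2) / √(1 - c' ^ 2) with hσ
  have hD : 6 / η ≤ √(1 - b' ^ 2) * √(1 - c' ^ 2) := by
    rw [← sqrt_mul (h6.le.trans hb6)]
    apply le_sqrt_of_sq_le
    rw [sq]
    exact mul_le_mul hb6 hc6 h6.le (h6.le.trans hb6)
  have hnum : |(a' - b' * c') - (a - b * c)| ≤ 4 * e := by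
    rw [show (a' - b' * c') - (a - b * c) = (a' - a) - (b' * (c' - c) + c * (b' - b)) by ring]
    have t1 : |b' * (c' - c)| ≤ 2 * e := by
      rw [abs_mul]; exact mul_le_mul hb2 hc (abs_nonneg _) (by norm_num)
    have t2 : |c * (b' - b)| ≤ 1 * e := by
      rw [abs_mul]; exact mul_le_mul hc1 hb (abs_nonneg _) (by norm_num)
    have t3 := abs_add_le (b' * (c' - c)) (c * (b' - b))
    have t4 := abs_sub (a' - a) (b' * (c' - c) + c * (b' - b))
    linarith
  have hdecomp : (a' - b' * c') / (√(1 - b' ^ 2) * √(1 - c' ^ 2)) - w =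
      ((a' - b' * c') - (a - b * c)) / (√(1 - b' ^ 2) * √(1 - c' ^ 2)) +
        w * ((ρ - 1) + (σ - 1) + (ρ - 1) * (σ - 1)) := by
    rw [hwdef, hρ, hσ]
    field_simp
    ring
  have p1 : |((a' - b' * c') - (a - b * c)) / (√(1 - b' ^ 2) * √(1 - c' ^ 2))| ≤
      4 * e / (6 / η) := by
    rw [abs_div, abs_of_pos (h6.trans_le hD)]
    gcongr
  have p1' : 4 * e / (6 / η) = 2 / 3 * (e * η) := by field_simp; ring
  have heη : 0 ≤ e * η := mul_nonneg he0 hη.le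
  have p2 : |(ρ - 1) + (σ - 1) + (ρ - 1) * (σ - 1)| ≤ 3 / 2 * (e * η) := by
    have t1 := abs_add_le ((ρ - 1) + (σ - 1)) ((ρ - 1) * (σ - 1))
    have t2 := abs_add_le (ρ - 1) (σ - 1)
    have t3 : |(ρ - 1) * (σ - 1)| ≤ e * η / 2 * 1 := by
      rw [abs_mul]
      exact mul_le_mul rb (by linarith) (abs_nonneg _) (by linarith)
    linarith
  have p3 : |w * ((ρ - 1) + (σ - 1) + (ρ - 1) * (σ - 1))| ≤ 1 * (3 / 2 * (e * η)) := by
    rw [abs_mul]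
    exact mul_le_mul hw p2 (abs_nonneg _) (by norm_num)
  rw [hdecomp]
  refine (abs_add_le _ _).trans ?_
  linarith

end Perturbation

/-! ### Norms, means and correlations as overlaps -/

section Statistics

variable {N : ℕ} {x y : Fin N → ℝ}

/-- The cosine of the angle between two vectors. -/
def cosine (x y : Fin N → ℝ) : ℝ := (∑ i, x i * y i) / (l2norm x * l2norm y)

/-- The cosine of the angle between a vector and the constant vector `1`. -/
def meanCosine (x : Fin N → ℝ) : ℝ := (∑ i, x i) / (√N * l2norm x)

theorem sq_l2norm (x : Fin N → ℝ) : l2norm x ^ 2 = ∑ i, x i * x i := by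
  rw [l2norm, Real.sq_sqrt (Finset.sum_nonneg fun i _ => sq_nonneg _)]
  exact Finset.sum_congr rfl fun i _ => sq _

theorem pos_of_stdDev_pos (hx : 0 < stdDev x) : 0 < N := by
  rcases Nat.eq_zero_or_pos N with rfl | h
  · simp [stdDev] at hx
  · exact h

theorem sum_centred_mul (hN : 0 < N) (x y : Fin N → ℝ) :
    ∑ i, (x i - mean x) * (y i - mean y) = ∑ i, x i * y i - (∑ i, x i) * (∑ i, y i) / N := by
  have hN' : (N : ℝ) ≠ 0 := by positivity
  have h : ∀ i, (x i - mean x) * (y i - mean y) =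
      x i * y i - mean x * y i - mean y * x i + mean x * mean y := fun i => by ring
  simp only [h, Finset.sum_add_distrib, Finset.sum_sub_distrib, ← Finset.mul_sum,
    Finset.sum_const, Finset.card_univ, Fintype.card_fin, nsmul_eq_mul]
  rw [mean, mean]
  field_simp
  ring

theorem l2norm_pos (hx : 0 < stdDev x) : 0 < l2norm x := by
  have hN := pos_of_stdDev_pos hx
  have hN' : (0 : ℝ) < N := by exact_mod_cast hN
  have h := Real.sqrt_pos.1 hx
  rw [div_pos_iff_of_pos_right hN'] at h
  simp only [sq, sum_centred_mul hN] at h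
  refine Real.sqrt_pos.2 ?_
  simp only [sq]
  have : 0 ≤ (∑ i, x i) * (∑ i, x i) / N := div_nonneg (mul_self_nonneg _) hN'.le
  linarith

theorem sum_centred_mul_eq (hx : 0 < stdDev x) (hy : 0 < stdDev y) :
    ∑ i, (x i - mean x) * (y i - mean y) =
      l2norm x * l2norm y * (cosine x y - meanCosine x * meanCosine y) := by
  have hN := pos_of_stdDev_pos hx
  have h1 := l2norm_pos hx
  have h2 := l2norm_pos hy
  have h3 : (0 : ℝ) < √N := Real.sqrt_pos.2 (by exact_mod_cast hN)
  rw [sum_centred_mul hN, cosine, meanCosine, meanCosine]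
  nth_rw 1 [← Real.sq_sqrt (Nat.cast_nonneg N)]
  field_simp

theorem cosine_self (hx : 0 < stdDev x) : cosine x x = 1 := by
  have h1 := l2norm_pos hx
  rw [cosine, ← sq_l2norm, sq, div_self (by positivity)]

theorem sum_centred_sq_eq (hx : 0 < stdDev x) :
    ∑ i, (x i - mean x) ^ 2 = l2norm x ^ 2 * (1 - meanCosine x ^ 2) := by
  simp only [sq]
  rw [sum_centred_mul_eq hx hx, cosine_self hx]

theorem one_sub_sq_meanCosine_pos (hx : 0 < stdDev x) : 0 < 1 - meanCosine x ^ 2 := by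
  have h := Real.sqrt_pos.1 hx
  rw [div_pos_iff_of_pos_right (by exact_mod_cast pos_of_stdDev_pos hx), sum_centred_sq_eq hx] at h
  exact pos_of_mul_pos_right h (sq_nonneg _)

theorem abs_meanCosine_le_one (hx : 0 < stdDev x) : |meanCosine x| ≤ 1 := by
  rw [← sq_le_one_iff_abs_le_one]
  linarith [one_sub_sq_meanCosine_pos hx]

theorem abs_cosine_le_one (hx : 0 < stdDev x) (hy : 0 < stdDev y) : |cosine x y| ≤ 1 := by
  have h1 := l2norm_pos hx
  have h2 := l2norm_pos hy
  rw [cosine, abs_div, abs_of_pos (mul_pos h1 h2), div_le_one (mul_pos h1 h2)]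
  refine abs_le_of_sq_le_sq ?_ (mul_pos h1 h2).le
  rw [mul_pow, sq_l2norm, sq_l2norm]
  simp only [← sq]
  exact Finset.sum_mul_sq_le_sq_mul_sq _ _ _

/-- Correlation in terms of the cosines `a` between two vectors and `b`, `c` between each of them
and the constant vector. -/
def correlation (a b c : ℝ) : ℝ := (a - b * c) / (√(1 - b ^ 2) * √(1 - c ^ 2))

theorem pearson_eq (hx : 0 < stdDev x) (hy : 0 < stdDev y) :
    pearson x y = correlation (cosine x y) (meanCosine x) (meanCosine y) := by
  have h1 := l2norm_pos hx
  have h2 := l2norm_pos hy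
  rw [pearson, sum_centred_mul_eq hx hy, sum_centred_sq_eq hx, sum_centred_sq_eq hy,
    Real.sqrt_mul (sq_nonneg _), Real.sqrt_mul (sq_nonneg _), Real.sqrt_sq h1.le,
    Real.sqrt_sq h2.le, mul_mul_mul_comm, mul_div_mul_left _ _ (by positivity), correlation]

theorem abs_pearson_le_one (x y : Fin N → ℝ) : |pearson x y| ≤ 1 := by
  rw [pearson, abs_div, abs_of_nonneg (by positivity : (0 : ℝ) ≤
    √(∑ i, (x i - mean x) ^ 2) * √(∑ i, (y i - mean y) ^ 2))]
  refine div_le_one_of_le₀ ?_ (by positivity)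
  rw [← Real.sqrt_mul (Finset.sum_nonneg fun i _ => sq_nonneg _)]
  exact Real.abs_le_sqrt (Finset.sum_mul_sq_le_sq_mul_sq _ _ _)

theorem mul_sq_stdDev (hx : 0 < stdDev x) :
    N * stdDev x ^ 2 = l2norm x ^ 2 * (1 - meanCosine x ^ 2) := by
  have hN : (N : ℝ) ≠ 0 := by exact_mod_cast (pos_of_stdDev_pos hx).ne'
  rw [← sum_centred_sq_eq hx, stdDev, Real.sq_sqrt (by positivity), mul_div_cancel₀ _ hN]

/-- The condition parameter bounds `1 - b²` from below for both vectors, where `b` is the cosine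
of the angle with the constant vector. -/
theorem seven_div_le_of_eta_le {η : ℝ} (hx : 0 < stdDev x) (hy : 0 < stdDev y)
    (h : eta x y ≤ η) : 7 ≤ η * (1 - meanCosine x ^ 2) ∧ 7 ≤ η * (1 - meanCosine y ^ 2) := by
  have hN : (0 : ℝ) < N := by exact_mod_cast pos_of_stdDev_pos hx
  have h1 := l2norm_pos hx
  have h2 := l2norm_pos hy
  set m := min (stdDev x * stdDev y) (min (stdDev x ^ 2) (stdDev y ^ 2)) with hm
  set M := max (l2norm x * l2norm y) (max (l2norm x ^ 2) (l2norm y ^ 2)) with hM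
  have hm0 : 0 < m := lt_min (by positivity) (lt_min (by positivity) (by positivity))
  have hM1 : l2norm x ^ 2 ≤ M := (le_max_left _ _).trans (le_max_right _ _)
  have hM2 : l2norm y ^ 2 ≤ M := (le_max_right _ _).trans (le_max_right _ _)
  have hm1 : m ≤ stdDev x ^ 2 := (min_le_right _ _).trans (min_le_left _ _)
  have hm2 : m ≤ stdDev y ^ 2 := (min_le_right _ _).trans (min_le_right _ _)
  have hη : 7 * M ≤ η * (N * m) := (div_le_iff₀ (by positivity)).1 h
  have hη0 : 0 ≤ η := by
    have : 0 ≤ η * (N * m) := le_trans (by positivity) hη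
    exact nonneg_of_mul_nonneg_left this (by positivity)
  have key : ∀ z : Fin N → ℝ, 0 < stdDev z → l2norm z ^ 2 ≤ M → m ≤ stdDev z ^ 2 →
      7 ≤ η * (1 - meanCosine z ^ 2) := fun z hz hzM hzm => by
    have hpos : 0 < l2norm z ^ 2 := pow_pos (l2norm_pos hz) 2
    refine le_of_mul_le_mul_left ?_ hpos
    calc l2norm z ^ 2 * 7 ≤ 7 * M := by linarith
      _ ≤ η * (N * m) := hη
      _ ≤ η * (N * stdDev z ^ 2) := by gcongr
      _ = l2norm z ^ 2 * (η * (1 - meanCosine z ^ 2)) := by rw [mul_sq_stdDev hz]; ring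
  exact ⟨key x hx hM1 hm1, key y hy hM2 hm2⟩

end Statistics

section AmplitudeEncoding

variable {N d : ℕ} {X : Matrix (Fin N) (Fin d) ℝ} {Y : Fin N → ℝ}
  {O : Source d → Matrix (Bits (Nat.clog 2 N)) (Bits (Nat.clog 2 N)) ℂ}

theorem sum_bits_eq (f : Fin N → ℂ) :
    ∑ b : Bits (Nat.clog 2 N), (if h : Nat.ofBits b < N then f ⟨Nat.ofBits b, h⟩ else 0) =
      ∑ i, f i := by
  classical
  have hlt : ∀ i : Fin N, (i : ℕ) < 2 ^ Nat.clog 2 N := fun i =>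
    i.2.trans_le (Nat.le_pow_clog (by norm_num) N)
  have hof : ∀ i : Fin N, Nat.ofBits (fun k : Fin (Nat.clog 2 N) => (i : ℕ).testBit k) = i :=
    fun i => by rw [Nat.ofBits_testBit, Nat.mod_eq_of_lt (hlt i)]
  symm
  refine Finset.sum_of_injOn (fun i k => (i : ℕ).testBit k) ?_ (fun _ _ => by simp) ?_ ?_
  · intro i _ j _ hij
    have := congrArg Nat.ofBits hij
    simp only [hof] at this
    exact Fin.ext this
  · intro b _ hb
    rw [dif_neg]
    intro h
    refine hb ⟨⟨Nat.ofBits b, h⟩, by simp, ?_⟩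
    funext k
    simp [Nat.testBit_ofBits_lt]
  · intro i _
    simp only [hof, i.2, dif_pos]

/-- The value of `overlap` in terms of the stored vectors. -/
def overlapValue (X : Matrix (Fin N) (Fin d) ℝ) (Y : Fin N → ℝ) :
    Option (Source d) → Source d → ℝ
  | some s, t => cosine (t.vec X Y) (s.vec X Y)
  | none, t => √N / √2 ^ Nat.clog 2 N * meanCosine (t.vec X Y)

theorem overlap_eq (hO : IsLoader X Y O) (hN : 0 < N) (p : Option (Source d)) (t : Source d) :
    overlap O p t = overlapValue X Y p t := by
  have hst : ∀ t v, star (O t v fun _ => false) = ampState (t.vec X Y) v := fun t v => by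
    rw [(hO t).2, ampState]
    split_ifs
    · exact Complex.conj_ofReal _
    · exact star_zero _
  cases p with
  | some s =>
    have hs := sum_bits_eq fun i : Fin N => ((t.vec X Y i / l2norm (t.vec X Y) *
      (s.vec X Y i / l2norm (s.vec X Y)) : ℝ) : ℂ)
    rw [← Complex.ofReal_sum] at hs
    rw [overlap, overlapValue, cosine, Finset.sum_div]
    simp only [div_mul_div_comm] at hs
    refine Eq.trans (Finset.sum_congr rfl fun v _ => ?_) hs
    change _ * O s v (fun _ => false) = _
    rw [hst, (hO s).2, ampState, ampState]
    split_ifs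
    · rw [← Complex.ofReal_mul, div_mul_div_comm]
    · exact zero_mul _
  | none =>
    have hs := sum_bits_eq fun i : Fin N => ((t.vec X Y i / l2norm (t.vec X Y) *
      (√2)⁻¹ ^ Nat.clog 2 N : ℝ) : ℂ)
    rw [← Complex.ofReal_sum, ← Finset.sum_mul, ← Finset.sum_div] at hs
    have hN' : (0 : ℝ) < √N := Real.sqrt_pos.2 (by exact_mod_cast hN)
    have e : (∑ i, t.vec X Y i) / l2norm (t.vec X Y) * (√2)⁻¹ ^ Nat.clog 2 N =
        overlapValue X Y none t := by
      rw [overlapValue, meanCosine, inv_pow]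
      field_simp
    rw [overlap, ← e]
    refine Eq.trans (Finset.sum_congr rfl fun v _ => ?_) hs
    change _ * ((√2 : ℂ)⁻¹ ^ _) = _
    rw [hst, ampState]
    split_ifs
    · push_cast; rfl
    · exact zero_mul _

/-- The length of the uniform superposition of all basis states, restricted to the first `N`. -/
theorem sqrt_div_sqrt_two_pow_bounds (hN : 0 < N) :
    0 < √(N : ℝ) / √2 ^ Nat.clog 2 N ∧ √(N : ℝ) / √2 ^ Nat.clog 2 N ≤ 1 ∧
      7 ≤ 10 * (√(N : ℝ) / √2 ^ Nat.clog 2 N) := by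
  have hN' : (0 : ℝ) < N := by exact_mod_cast hN
  have h1 : (N : ℝ) ≤ 2 ^ Nat.clog 2 N := by exact_mod_cast Nat.le_pow_clog (by norm_num) N
  have h2 : (2 : ℝ) ^ Nat.clog 2 N ≤ 2 * N := by
    rcases Nat.lt_or_ge 1 N with h | h
    · have h3 := Nat.pow_pred_clog_lt_self (b := 2) (by norm_num) h
      have h4 : 2 ^ Nat.clog 2 N = 2 * 2 ^ (Nat.clog 2 N).pred := by
        rw [← pow_succ', ← Nat.succ_eq_add_one,
          Nat.succ_pred_eq_of_pos (Nat.clog_pos (by norm_num) h)]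
      have : 2 ^ Nat.clog 2 N ≤ 2 * N := by lia
      exact_mod_cast this
    · obtain rfl : N = 1 := le_antisymm h hN
      norm_num
  have hsq : (√2 ^ Nat.clog 2 N) ^ 2 = (2 : ℝ) ^ Nat.clog 2 N := by
    rw [← pow_mul, mul_comm, pow_mul, Real.sq_sqrt (by norm_num)]
  have hp : 0 < √2 ^ Nat.clog 2 N := by positivity
  have hs : 0 < √(N : ℝ) := Real.sqrt_pos.2 hN'
  have hs2 := Real.sq_sqrt hN'.le
  refine ⟨by positivity, ?_, ?_⟩
  · rw [div_le_one hp]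
    exact Real.sqrt_le_iff.2 ⟨hp.le, by rwa [hsq]⟩
  · rw [mul_div_assoc', le_div_iff₀ hp]
    refine abs_le_of_sq_le_sq' ?_ (by positivity) |>.2
    rw [mul_pow, mul_pow, hsq, hs2]
    linarith

theorem abs_overlapValue_le_one (hX : ∀ j, 0 < stdDev (fun i => X i j)) (hY : 0 < stdDev Y)
    (p : Option (Source d)) (t : Source d) : |overlapValue X Y p t| ≤ 1 := by
  have h : ∀ s : Source d, 0 < stdDev (s.vec X Y) := fun s => by
    cases s with
    | feature j => exact hX j
    | label => exact hY
  cases p with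
  | some s => exact abs_cosine_le_one (h t) (h s)
  | none =>
    obtain ⟨h0, h1, -⟩ := sqrt_div_sqrt_two_pow_bounds (pos_of_stdDev_pos hY)
    rw [overlapValue, abs_mul, abs_of_pos h0]
    exact mul_le_one₀ h1 (abs_nonneg _) (abs_meanCosine_le_one (h t))

end AmplitudeEncoding

/-! ### The algorithm -/

section Algorithm

variable {N d : ℕ}

/-- The three overlaps that determine the correlation of a feature vector with the label vector:
of the two vectors, and of each of them with the uniform superposition. -/
def task (j : Fin d) : Fin 3 → Option (Source d) × Source d
  | 0 => (some .label, .feature j)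
  | 1 => (none, .feature j)
  | 2 => (none, .label)

/-- The index of a circuit: a feature vector, one of its three overlaps, a level `i < K`, and the
choice between `2 ^ i - 1` and `2 ^ i` Grover iterations. -/
abbrev CircuitIndex (d K : ℕ) : Type := (Fin d × Fin 3) × (Fin K × Bool)

/-- The number of Grover iterations. -/
def iterations {K : ℕ} (x : Fin K × Bool) : ℕ := 2 ^ (x.1 : ℕ) - if x.2 then 0 else 1

/-- The circuit with a given index. -/
def circuit {n K : ℕ} (x : CircuitIndex d K) : List (Gate n d (n + 1)) :=
  grover (overlapCircuit (task x.1.1 x.1.2).1 (task x.1.1 x.1.2).2) (iterations x.2)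

/-- The number of runs of a circuit: the failure probability is smaller on the low levels, where
circuits are cheap, so that the total failure probability does not grow with `K`. The factor is
`24²`, as the frequencies are needed up to `1/24`. -/
def runs {K : ℕ} (l : ℕ) (x : CircuitIndex d K) : ℕ := 576 * (l + (K - (x.2.1 : ℕ)))

/-- The estimate of an overlap from the recorded numbers of outcomes `0…0`. -/
def overlapEstimate {K : ℕ} (l : ℕ) (r : CircuitIndex d K → ℕ) (j : Fin d) (t : Fin 3) : ℝ :=
  estimate fun (i : Fin K) (v : Bool) =>
    (r ((j, t), (i, v)) : ℝ) / (runs l (((j, t), (i, v)) : CircuitIndex d K) : ℕ)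

/-- The estimates of all correlations. The overlaps with the uniform superposition of all basis
states are rescaled, since `N` need not be a power of two. -/
def correlationEstimate {K : ℕ} (N l : ℕ) (r : CircuitIndex d K → ℕ) (j : Fin d) : ℝ :=
  correlation (overlapEstimate l r j 0)
    (√2 ^ Nat.clog 2 N / √N * overlapEstimate l r j 1)
    (√2 ^ Nat.clog 2 N / √N * overlapEstimate l r j 2)

/-- The quantum algorithm with `K` levels and confidence parameter `l`. -/
def pearsonAlgo (N d K l : ℕ) : Algo (Nat.clog 2 N) d :=
  measureAll circuit (runs l) (correlationEstimate N l)
    (Finset.univ : Finset (CircuitIndex d K)).toList fun _ => 0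

section Time

theorem circuit_time_le {n K : ℕ} {T : ℝ} (hT : 1 ≤ T) (hn : (n : ℝ) ≤ T)
    (x : CircuitIndex d K) :
    ((n + 1 : ℕ) : ℝ) + gatesTime T (circuit (n := n) x) ≤ 32 * T * 2 ^ (x.2.1 : ℕ) := by
  have hA := gatesTime_overlapCircuit_le hT hn (task x.1.1 x.1.2).1 (task x.1.1 x.1.2).2
  have hm : (iterations x.2 : ℝ) ≤ 2 ^ (x.2.1 : ℕ) := by
    have : iterations x.2 ≤ 2 ^ (x.2.1 : ℕ) := Nat.sub_le _ _
    exact_mod_cast this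
  have h1 : (1 : ℝ) ≤ 2 ^ (x.2.1 : ℕ) := one_le_pow₀ (by norm_num)
  rw [circuit, gatesTime_grover]
  set a := gatesTime T (overlapCircuit (n := n) (task x.1.1 x.1.2).1 (task x.1.1 x.1.2).2)
  have hstep : 6 * ((n : ℝ) + 1) + 2 * a ≤ 24 * T := by linarith
  have hm0 : (0 : ℝ) ≤ iterations x.2 := Nat.cast_nonneg _
  have hit : (iterations x.2 : ℝ) * (6 * ((n : ℝ) + 1) + 2 * a) ≤ 2 ^ (x.2.1 : ℕ) * (24 * T) :=
    (mul_le_mul_of_nonneg_left hstep hm0).trans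
      (mul_le_mul_of_nonneg_right hm (by linarith))
  push_cast
  nlinarith

theorem sum_level_cost_le (l K : ℕ) :
    ∑ i : Fin K, (l + (K - (i : ℕ))) * 2 ^ (i : ℕ) ≤ (l + 2) * 2 ^ K := by
  rw [Fin.sum_univ_eq_sum_range (fun i => (l + (K - i)) * 2 ^ i)]
  induction K with
  | zero => simp
  | succ K ih =>
    have hgeom : ∑ i ∈ Finset.range K, 2 ^ i ≤ 2 ^ K :=
      (Nat.geomSum_eq le_rfl K).le.trans (by simp)
    have e : ∑ i ∈ Finset.range K, (l + (K + 1 - i)) * 2 ^ i =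
        ∑ i ∈ Finset.range K, (l + (K - i)) * 2 ^ i + ∑ i ∈ Finset.range K, 2 ^ i := by
      rw [← Finset.sum_add_distrib]
      refine Finset.sum_congr rfl fun i hi => ?_
      rw [Nat.succ_sub (Finset.mem_range.1 hi).le, Nat.succ_eq_add_one]
      ring
    rw [Finset.sum_range_succ, e, pow_succ, Nat.add_sub_cancel_left]
    nlinarith

theorem pearsonAlgo_runsWithin {K l : ℕ} {T t : ℝ} (hT : 1 ≤ T) (hn : (Nat.clog 2 N : ℝ) ≤ T)
    (nrm : Source d → ℝ) (ht : 110592 * d * T * ((l + 2) * 2 ^ K) ≤ t) :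
    (pearsonAlgo N d K l).RunsWithin T nrm t := by
  have hcost : ((Finset.univ : Finset (CircuitIndex d K)).toList.map fun x =>
      (runs l x : ℝ) * (((Nat.clog 2 N + 1 : ℕ) : ℝ) +
        gatesTime T (circuit (n := Nat.clog 2 N) x))).sum ≤ t := by
    rw [Finset.sum_map_toList]
    refine le_trans ?_ ht
    calc _ ≤ ∑ x : CircuitIndex d K,
          (18432 * T) * (((l + (K - (x.2.1 : ℕ))) * 2 ^ (x.2.1 : ℕ) : ℕ) : ℝ) := by
            refine Finset.sum_le_sum fun x _ => ?_
            refine (mul_le_mul_of_nonneg_left (circuit_time_le hT hn x)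
              (Nat.cast_nonneg _)).trans (le_of_eq ?_)
            rw [runs, Nat.cast_mul, Nat.cast_mul]
            push_cast
            ring
      _ = 110592 * d * T *
          ((∑ i : Fin K, (l + (K - (i : ℕ))) * 2 ^ (i : ℕ) : ℕ) : ℝ) := by
            rw [← Finset.mul_sum, ← Nat.cast_sum, Fintype.sum_prod_type]
            simp only [Fintype.sum_prod_type, Finset.sum_const, Finset.card_univ,
              Fintype.card_prod, Fintype.card_fin, Fintype.card_bool, smul_eq_mul,
              ← Finset.mul_sum]
            push_cast
            ring
      _ ≤ _ := by
            refine mul_le_mul_of_nonneg_left ?_ (by positivity)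
            exact_mod_cast sum_level_cost_le l K
  have h := measureAll_runsWithin (nrm := nrm) (T := T) (sub_nonneg.2 hcost)
    (circuit (n := Nat.clog 2 N)) (runs l) (correlationEstimate N l)
    (Finset.univ : Finset (CircuitIndex d K)).toList fun _ => 0
  rwa [sub_add_cancel] at h

end Time

section Correctness

variable {X : Matrix (Fin N) (Fin d) ℝ} {Y : Fin N → ℝ}
  {O : Source d → Matrix (Bits (Nat.clog 2 N)) (Bits (Nat.clog 2 N)) ℂ}

/-- The probability of the outcome `0…0` is `cos² ((2m+1)θ)` after `m` Grover iterations. -/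
theorem norm_sq_finalState_circuit (hX : ∀ j, 0 < stdDev (fun i => X i j)) (hY : 0 < stdDev Y)
    (hO : IsLoader X Y O) {K : ℕ} (x : CircuitIndex d K) :
    ‖finalState O (circuit x) fun _ => false‖ ^ 2 =
      Real.cos ((2 * (2 ^ (x.2.1 : ℕ) - if x.2.2 then 0 else 1) + 1) *
        windowAngle (overlapValue X Y (task x.1.1 x.1.2).1 (task x.1.1 x.1.2).2)) ^ 2 := by
  set a := overlapValue X Y (task x.1.1 x.1.2).1 (task x.1.1 x.1.2).2 with ha
  have ha1 : |a| ≤ 1 := abs_overlapValue_le_one hX hY _ _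
  have hθ := windowAngle_mem ha1
  have hsin : Real.sin (windowAngle a) ≠ 0 :=
    (Real.sin_pos_of_pos_of_lt_pi (by linarith [hθ.1, Real.pi_pos])
      (by linarith [hθ.2, Real.pi_pos])).ne'
  have hc : runCircuit O (overlapCircuit (task x.1.1 x.1.2).1 (task x.1.1 x.1.2).2)
      (zeroKet (Nat.clog 2 N + 1)) (fun _ => false) = Real.cos (windowAngle a) := by
    rw [runCircuit_overlapCircuit, overlap_eq hO (pos_of_stdDev_pos hY), ← ha,
      cos_windowAngle ha1, windowAmp]
    push_cast
    ring
  rw [circuit, norm_sq_finalState_grover (fun s => (hO s).1) _ _ hsin hc]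
  have hm : (iterations x.2 : ℝ) = 2 ^ (x.2.1 : ℕ) - if x.2.2 then 0 else 1 := by
    have : 1 ≤ 2 ^ (x.2.1 : ℕ) := Nat.one_le_two_pow
    rw [iterations]
    split_ifs <;> simp [this]
  rw [hm]

theorem abs_overlapEstimate_sub_le (hX : ∀ j, 0 < stdDev (fun i => X i j)) (hY : 0 < stdDev Y)
    (hO : IsLoader X Y O) {K l : ℕ} (hK : 0 < K) {r : CircuitIndex d K → ℕ} {j : Fin d}
    (hr : ∀ x : CircuitIndex d K, x.1.1 = j →
      |r x - ‖finalState O (circuit x) fun _ => false‖ ^ 2 * runs l x| ≤ 1 / 24 * runs l x)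
    (t : Fin 3) :
    |overlapEstimate l r j t - overlapValue X Y (task j t).1 (task j t).2| ≤ 7 / 2 ^ K := by
  refine abs_estimate_sub_le hK ⟨abs_overlapValue_le_one hX hY _ _, fun i v => ?_⟩
  have h := hr ((j, t), (i, v)) rfl
  rw [norm_sq_finalState_circuit hX hY hO] at h
  have hs : (0 : ℝ) < runs l (((j, t), (i, v)) : CircuitIndex d K) := by
    have : 0 < runs l (((j, t), (i, v)) : CircuitIndex d K) := by
      have := i.2
      simp only [runs]
      lia
    exact_mod_cast this
  rw [div_sub' hs.ne', abs_div, abs_of_pos hs, div_le_iff₀ hs, mul_comm (runs l _ : ℝ)]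
  exact h

theorem abs_correlationEstimate_sub_le (hX : ∀ j, 0 < stdDev (fun i => X i j))
    (hY : 0 < stdDev Y) (hO : IsLoader X Y O) {K l : ℕ} (hK : 0 < K) {ε η : ℝ} (hε : ε ≤ 1)
    (hη : 0 < η) (hKη : 40 * η ≤ ε * 2 ^ K) {r : CircuitIndex d K → ℕ} {j : Fin d}
    (hj : eta (fun i => X i j) Y ≤ η)
    (hr : ∀ x : CircuitIndex d K, x.1.1 = j →
      |r x - ‖finalState O (circuit x) fun _ => false‖ ^ 2 * runs l x| ≤ 1 / 24 * runs l x) :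
    |correlationEstimate N l r j - pearson (fun i => X i j) Y| ≤ ε := by
  have hest := abs_overlapEstimate_sub_le hX hY hO hK hr
  obtain ⟨hκ0, -, hκ7⟩ := sqrt_div_sqrt_two_pow_bounds (pos_of_stdDev_pos hY)
  obtain ⟨hη1, hη2⟩ := seven_div_le_of_eta_le (hX j) hY hj
  have hinv : √2 ^ Nat.clog 2 N / √(N : ℝ) = (√(N : ℝ) / √2 ^ Nat.clog 2 N)⁻¹ :=
    (inv_div _ _).symm
  have h2K : (0 : ℝ) < 2 ^ K := by positivity
  rw [pearson_eq (hX j) hY, correlationEstimate, hinv]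
  set κ := √(N : ℝ) / √2 ^ Nat.clog 2 N with hκ
  have hκinv : κ⁻¹ ≤ 10 / 7 := by
    rw [inv_le_comm₀ hκ0 (by norm_num)]
    linarith
  have hscale : ∀ (t : Fin 3) (b : ℝ),
      overlapValue X Y (task j t).1 (task j t).2 = κ * b →
        |κ⁻¹ * overlapEstimate l r j t - b| ≤ 10 / 2 ^ K := fun t b hb => by
    have h := hest t
    rw [hb] at h
    have e : κ⁻¹ * overlapEstimate l r j t - b = κ⁻¹ * (overlapEstimate l r j t - κ * b) := by
      field_simp
    rw [e, abs_mul, abs_of_pos (inv_pos.2 hκ0)]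
    calc _ ≤ 10 / 7 * (7 / 2 ^ K) := mul_le_mul hκinv h (abs_nonneg _) (by norm_num)
      _ = 10 / 2 ^ K := by ring
  have hbound : ∀ t : Fin 3, |κ⁻¹ * overlapEstimate l r j t| ≤ 2 := fun t => by
    have h : |overlapEstimate l r j t| ≤ 1 := abs_estimate_le_one _
    rw [abs_mul, abs_of_pos (inv_pos.2 hκ0)]
    have := inv_pos.2 hκ0
    nlinarith [abs_nonneg (overlapEstimate l r j t)]
  have hw := abs_pearson_le_one (fun i => X i j) Y
  rw [pearson_eq (hX j) hY] at hw
  refine abs_correlation_sub_le (e := 10 / 2 ^ K) hη hε ?_ ?_ (hscale 1 _ rfl) (hscale 2 _ rfl)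
    (abs_meanCosine_le_one (hX j)) (abs_meanCosine_le_one hY) (hbound 1) (hbound 2) ?_ ?_ hw
  · rw [show 4 * (10 / 2 ^ K * η) = 40 * η / 2 ^ K by ring, div_le_iff₀ h2K]
    exact hKη
  · exact (hest 0).trans (by gcongr; norm_num)
  · rw [div_le_iff₀ hη, mul_comm]
    exact hη1
  · rw [div_le_iff₀ hη, mul_comm]
    exact hη2

theorem sum_exp_level_le (K : ℕ) :
    ∑ i : Fin K, Real.exp (-((K - (i : ℕ) : ℕ) : ℝ)) ≤ 1 := by
  rw [Fin.sum_univ_eq_sum_range (fun i => Real.exp (-((K - i : ℕ) : ℝ)))]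
  induction K with
  | zero => simp
  | succ K ih =>
    have he : Real.exp (-1) ≤ 1 / 2 := by
      rw [Real.exp_neg, inv_le_comm₀ (Real.exp_pos _) (by norm_num)]
      linarith [Real.add_one_le_exp (1 : ℝ)]
    have e : ∑ i ∈ Finset.range K, Real.exp (-((K + 1 - i : ℕ) : ℝ)) =
        Real.exp (-1) * ∑ i ∈ Finset.range K, Real.exp (-((K - i : ℕ) : ℝ)) := by
      rw [Finset.mul_sum]
      refine Finset.sum_congr rfl fun i hi => ?_
      rw [Nat.succ_sub (Finset.mem_range.1 hi).le, ← Real.exp_add]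
      push_cast
      ring_nf
    rw [Finset.sum_range_succ, e, Nat.add_sub_cancel_left, Nat.cast_one]
    nlinarith [Real.exp_pos (-1)]

theorem le_prob_pearsonAlgo (hX : ∀ j, 0 < stdDev (fun i => X i j))
    (hY : 0 < stdDev Y) (hO : IsLoader X Y O) {K l : ℕ} (hK : 0 < K) {δ ε η : ℝ} (hε : ε ≤ 1)
    (hη : 0 < η) (hKη : 40 * η ≤ ε * 2 ^ K) (hl : Real.exp (-l) ≤ δ / 12) (nrm : Source d → ℝ)
    (j : Fin d) (hj : eta (fun i => X i j) Y ≤ η) :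
    1 - δ ≤ (pearsonAlgo N d K l).prob O nrm {w | |w j - pearson (fun i => X i j) Y| ≤ ε} := by
  have h := le_prob_measureAll (nrm := nrm)
    (E := {w | |w j - pearson (fun i => X i j) Y| ≤ ε}) (fun s => (hO s).1)
    (circuit (n := Nat.clog 2 N)) (runs l) (correlationEstimate N l)
    {x : CircuitIndex d K | x.1.1 = j} (τ := 1 / 24) (by norm_num) (by norm_num)
    (Finset.univ : Finset (CircuitIndex d K)).toList (Finset.nodup_toList _) (fun _ => 0)
    fun r _ hr => abs_correlationEstimate_sub_le hX hY hO hK hε hη hKη hj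
      fun x hx => hr x (by simp) hx
  refine le_trans (sub_le_sub_left ?_ 1) h
  rw [Finset.sum_map_toList]
  have hfail : ∀ x : CircuitIndex d K, 2 * Real.exp (-((1 / 24) ^ 2 * (runs l x : ℝ))) =
      2 * Real.exp (-l) * Real.exp (-((K - (x.2.1 : ℕ) : ℕ) : ℝ)) := fun x => by
    rw [mul_assoc, ← Real.exp_add, runs]
    push_cast
    ring_nf
  have hsum : ∑ x : CircuitIndex d K, (if x ∈ {x : CircuitIndex d K | x.1.1 = j} then
      2 * Real.exp (-((1 / 24) ^ 2 * (runs l x : ℝ))) else 0) =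
      12 * Real.exp (-l) * ∑ i : Fin K, Real.exp (-((K - (i : ℕ) : ℕ) : ℝ)) := by
    simp only [hfail, Set.mem_ofPred_eq]
    rw [Fintype.sum_prod_type, Fintype.sum_prod_type,
      Finset.sum_eq_single j (fun j' _ h => by simp [h]) (by simp)]
    simp only [if_true, Fintype.sum_prod_type, Finset.sum_const, Finset.card_univ,
      Fintype.card_fin, Fintype.card_bool, nsmul_eq_mul, ← Finset.mul_sum]
    push_cast
    ring
  rw [hsum]
  nlinarith [sum_exp_level_le K, Real.exp_pos (-(l : ℝ))]

end Correctness

end Algorithm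

end PearsonQ

end

open PearsonQ in
theorem mainTheorem3 :
    ∃ C : ℝ, 0 < C ∧
      ∀ (N d : ℕ) (ε δ η : ℝ), 0 < ε → 0 < δ → δ < 1 →
        ∃ A : Algo (Nat.clog 2 N) d,
          ∀ (X : Matrix (Fin N) (Fin d) ℝ) (Y : Fin N → ℝ),
            (∀ j, 0 < stdDev (fun i => X i j)) → 0 < stdDev Y →
            (∀ j, eta (fun i => X i j) Y ≤ η) →
            (∀ T : ℝ, (Nat.clog 2 N : ℝ) ≤ T →
              A.RunsWithin T (fun s => l2norm (s.vec X Y))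
                (C * (T * d * η / ε) * Real.log (2 / δ))) ∧
            ∀ O : Source d → Matrix (Bits (Nat.clog 2 N)) (Bits (Nat.clog 2 N)) ℂ,
              IsLoader X Y O →
              ∀ j : Fin d,
                1 - δ ≤ A.prob O (fun s => l2norm (s.vec X Y))
                  {w | |w j - pearson (fun i => X i j) Y| ≤ ε} := by
  refine ⟨79626240, by norm_num, fun N d ε δ η hε hδ hδ1 => ?_⟩
  have hlog2 : 0.69 < Real.log 2 := lt_trans (by norm_num) Real.log_two_gt_d9
  have hL : Real.log 2 ≤ Real.log (2 / δ) :=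
    Real.log_le_log (by norm_num) (by rw [le_div_iff₀ hδ]; linarith)
  -- `η ≥ 7` is forced by a single feature vector.
  have hη7 : ∀ (X : Matrix (Fin N) (Fin d) ℝ) (Y : Fin N → ℝ),
      (∀ j, 0 < stdDev (fun i => X i j)) → 0 < stdDev Y →
      (∀ j, eta (fun i => X i j) Y ≤ η) → ∀ _ : Fin d, 7 ≤ η := by
    intro X Y hX hY hη j
    have h7 := (seven_div_le_of_eta_le (hX j) hY (hη j)).1
    have h1 := one_sub_sq_meanCosine_pos (hX j)
    nlinarith [sq_nonneg (meanCosine fun i => X i j)]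
  by_cases hcase : ε < 1 ∧ 7 ≤ η
  · obtain ⟨hε1, hη⟩ := hcase
    -- The number `k + 1` of levels is such that `40 η / ε < 2 ^ (k + 1) ≤ 80 η / ε`, and the
    -- confidence parameter such that `exp (-l) ≤ δ / 12`.
    have hx : 1 ≤ 40 * η / ε := by rw [le_div_iff₀ hε]; linarith
    obtain ⟨k, hk1, hk2⟩ := exists_nat_pow_near hx (by norm_num : (1 : ℝ) < 2)
    set l := ⌈Real.log (12 / δ)⌉₊ with hl
    have hl1 : Real.log (12 / δ) ≤ l := Nat.le_ceil _
    have h12 : Real.log (12 / δ) ≤ Real.log (2 / δ) + 3 * Real.log 2 := by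
      rw [← Real.log_rpow (by norm_num), ← Real.log_mul (by positivity) (by positivity)]
      refine Real.log_le_log (by positivity) ?_
      rw [div_mul_eq_mul_div]
      norm_num
      gcongr
      norm_num
    have hlL : (l : ℝ) + 2 ≤ 9 * Real.log (2 / δ) := by
      have h0 : 0 ≤ Real.log (12 / δ) := Real.log_nonneg (by rw [le_div_iff₀ hδ]; linarith)
      have := Nat.ceil_lt_add_one h0
      linarith
    have hexp : Real.exp (-l) ≤ δ / 12 := by
      rw [← Real.exp_log (by positivity : 0 < δ / 12), Real.exp_le_exp,
        ← inv_div 12 δ, Real.log_inv]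
      linarith
    refine ⟨pearsonAlgo N d (k + 1) l, fun X Y hX hY hηj => ⟨fun T hT => ?_, fun O hO j => ?_⟩⟩
    · have hN : 1 < N := by
        by_contra h
        obtain rfl : N = 1 := le_antisymm (not_lt.1 h) (pos_of_stdDev_pos hY)
        simp [stdDev, mean] at hY
      have hT1 : 1 ≤ T := by
        have : 1 ≤ Nat.clog 2 N := Nat.clog_pos (by norm_num) hN
        exact le_trans (by exact_mod_cast this) hT
      refine pearsonAlgo_runsWithin hT1 hT _ ?_
      have hpow : (2 : ℝ) ^ (k + 1) ≤ 80 * η / ε := by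
        rw [pow_succ]
        calc (2 : ℝ) ^ k * 2 ≤ 40 * η / ε * 2 := by gcongr
          _ = 80 * η / ε := by ring
      calc 110592 * (d : ℝ) * T * ((l + 2) * 2 ^ (k + 1))
          ≤ 110592 * d * T * (9 * Real.log (2 / δ) * (80 * η / ε)) := by
            gcongr
            linarith
        _ = 79626240 * (T * d * η / ε) * Real.log (2 / δ) := by ring
    · refine le_prob_pearsonAlgo hX hY hO (K := k + 1) k.succ_pos hε1.le (by linarith) ?_ hexp _ j (hηj j)
      have := (div_lt_iff₀ hε).1 hk2
      linarith
  -- Every correlation is within `1` of `0`, so nothing need be measured if `1 ≤ ε`.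
  · refine ⟨.output 0, fun X Y hX hY hη => ⟨fun T hT => ?_, fun O _ j => ?_⟩⟩
    · have hT0 : 0 ≤ T := le_trans (Nat.cast_nonneg _) hT
      have hL0 : 0 ≤ Real.log (2 / δ) := by linarith
      rw [Algo.RunsWithin]
      rcases Nat.eq_zero_or_pos d with rfl | hd
      · simp
      · have := hη7 X Y hX hY hη ⟨0, hd⟩
        positivity
    · have hε1 : 1 ≤ ε := by
        by_contra h
        exact hcase ⟨not_le.1 h, hη7 X Y hX hY hη j⟩
      have hmem : (0 : Fin d → ℝ) ∈ {w : Fin d → ℝ | |w j - pearson (fun i => X i j) Y| ≤ ε} := by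
        change |0 - pearson (fun i => X i j) Y| ≤ ε
        rw [zero_sub, abs_neg]
        exact (abs_pearson_le_one _ _).trans hε1
      rw [Algo.prob, if_pos hmem]
      linarith
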